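/- Let $p$ be an odd prime, $\mathbb{F}$ an algebraically closed field of characteristic $p$, $G=SL_2(\mathbb{F}_p)$, and $B\le G$ the subgroup of upper triangular matrices; all modules are right modules. For $a\in\mathbb{Z}$ let $S_a$ be the one-dimensional $\mathbb{F}[B]$-module on which $\begin{pmatrix}\alpha&\beta\\0&\alpha^{-1}\end{pmatrix}$ acts as multiplication by $\alpha^a$. For $1\le t\le p$ let $V_t\subseteq\mathbb{F}[x,y]$ be the space of homogeneous polynomials of degree $t-1$, on which $\begin{pmatrix}\alpha&\beta\\\gamma&\delta\end{pmatrix}\in G$ acts by the substitution $x\mapsto\alpha x+\beta y$, $y\mapsto\gamma x+\delta y$. A non-projective indecomposable $\mathbb{F}[G]$-module $M$ is called a Green correspondent of a non-projective indecomposable $\mathbb{F}[B]$-module $N$ if $\mathrm{Res}^G_B(M)\cong N\oplus Q$ and $\mathrm{Ind}_B^G(N)\cong M\oplus P$ with $Q$ and $P$ projective. Let $0\le a\le p-2$. Then the composition factors of $\mathrm{Ind}_B^G(S_a)$, counted with multiplicity, are $V_{a+1}$ and $V_{p-a}$. If moreover $a\ne 0$, then $\mathrm{Ind}_B^G(S_a)$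 is uniserial with socle isomorphic to $V_{a+1}$ and top isomorphic to $V_{p-a}$, and it is, up to isomorphism, the unique Green correspondent $V_{a,1}$ of $S_a$. -/

import Mathlib

open scoped MonoidAlgebra MatrixGroups

noncomputable section

namespace SLTwo

/-! ### General module theory -/

section Modules

variable (A : Type*) [Ring A] (M : Type*) [AddCommGroup M] [Module A M]

/-- `M` is indecomposable: it is nonzero and not the direct sum of two nonzero submodules. -/
def IsIndecomposable : Prop :=
  Nontrivial M ∧ ∀ N N' : Submodule A M, IsCompl N N' → N = ⊥ ∨ N' = ⊥

/-- `M` is uniserial: its submodules form a chain. -/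
def IsUniserial : Prop :=
  ∀ N N' : Submodule A M, N ≤ N' ∨ N' ≤ N

/-- The socle of `M`: the sum of all simple submodules. -/
def socle : Submodule A M :=
  sSup {N : Submodule A M | IsSimpleModule A N}

/-- The top (head) of `M`: the quotient by the radical, which is the intersection of all maximal
submodules. -/
abbrev Top : Type _ := M ⧸ Module.jacobson A M

/-- The composition factors of `M`, counted with multiplicity and up to isomorphism, are the
modules `N i`: there is a composition series from `0` to `M`, and the subquotients of any
such series are, in some order, isomorphic to the modules `N i`. -/
def HasCompositionFactors {ι : Type*} (N : ι → Type*) [∀ i, AddCommGroup (N i)]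
    [∀ i, Module A (N i)] : Prop :=
  (∃ s : CompositionSeries (Submodule A M), s.head = ⊥ ∧ s.last = ⊤) ∧
  ∀ s : CompositionSeries (Submodule A M), s.head = ⊥ → s.last = ⊤ →
    ∃ e : Fin s.length ≃ ι, ∀ i : Fin s.length,
      Nonempty ((s i.succ ⧸ (s i.castSucc).submoduleOf (s i.succ)) ≃ₗ[A] N (e i))

/-- `M` is the direct sum of a module isomorphic to `N` and a projective module. -/
def IsSumProjective (N : Type*) [AddCommGroup N] [Module A N] : Prop :=
  ∃ N' P : Submodule A M, IsCompl N' P ∧ Nonempty (N' ≃ₗ[A] N) ∧ Module.Projective A P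

end Modules

/-! ### The group `SL₂(𝔽_p)` and its modules

All modules are right modules. A right module over the group algebra of a group `G` is a
representation of the opposite group `Gᵐᵒᵖ`: `ρ (op g) v` is `v · g`. -/

variable (p : ℕ) [Fact p.Prime]

/-- `G = SL₂(𝔽_p)`. -/
abbrev G : Type := SL(2, ZMod p)

/-- The subgroup of upper triangular matrices of `G`. -/
def borel : Subgroup (G p) where
  carrier := {g | g 1 0 = 0}
  one_mem' := by simp
  mul_mem' := by
    intro g h hg hh
    simp only [Set.mem_ofPred_eq] at hg hh ⊢
    simp [Matrix.mul_apply, Fin.sum_univ_two, hg, hh]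
  inv_mem' := by
    intro g hg
    simp only [Set.mem_ofPred_eq] at hg ⊢
    simp [Matrix.SpecialLinearGroup.coe_inv, Matrix.adjugate_fin_two, hg]

/-- The subgroup of upper triangular matrices, inside the opposite group of `G`; its
representations are the right modules of the upper triangular group. -/
abbrev Bop : Subgroup (G p)ᵐᵒᵖ := (borel p).op

variable (F : Type*) [Field F] [CharP F p]

/-- The inclusion of the prime field. -/
abbrev incl : ZMod p →+* F := ZMod.castHom dvd_rfl F

/-- The one-dimensional module `S_a` of the upper triangular group: an upper triangular matrix
with upper left entry `α` acts as multiplication by `α ^ a`. In particular unitriangular matrices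
act trivially and `diag(ζ, ζ⁻¹)` acts as `ζ ^ a`. -/
def S (a : ℤ) : Representation F (Bop p) F where
  toFun b := ((incl p F (b.1.unop 0 0)) ^ a) • LinearMap.id
  map_one' := by
    ext
    simp
  map_mul' b c := by
    have hb : b.1.unop 1 0 = 0 := b.2
    ext
    simp [Matrix.mul_apply, Fin.sum_univ_two, mul_zpow, hb]

/-- The substitution `x ↦ αx + βy`, `y ↦ γx + δy` on `F[x, y]` given by the matrix
`(α β; γ δ)`; here `x` is `X 0` and `y` is `X 1`. -/
def subst (g : G p) : MvPolynomial (Fin 2) F →ₐ[F] MvPolynomial (Fin 2) F :=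
  MvPolynomial.aeval fun i => ∑ j, MvPolynomial.C (incl p F (g i j)) * MvPolynomial.X j

/-- `F[x, y]` as a right module of `G`, acting by substitutions. -/
def polyRep : Representation F (G p)ᵐᵒᵖ (MvPolynomial (Fin 2) F) where
  toFun g := (subst p F g.unop).toLinearMap
  map_one' := by
    have : subst p F (1 : G p) = AlgHom.id F _ := by
      ext i : 1
      fin_cases i <;> simp [subst, Fin.sum_univ_two]
    simp only [MulOpposite.unop_one, this]
    rfl
  map_mul' g h := by
    have : subst p F (h.unop * g.unop) = (subst p F g.unop).comp (subst p F h.unop) := by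
      ext i : 1
      simp [subst, Matrix.mul_apply, Fin.sum_univ_two]
      ring
    simp only [MulOpposite.unop_mul, this]
    rfl

/-- The module `V_t` (for `t ≥ 1`): homogeneous polynomials of degree `t - 1` in `x, y`, with
the action of `G` by substitutions. -/
def V (t : ℕ) :
    Representation F (G p)ᵐᵒᵖ (MvPolynomial.homogeneousSubmodule (Fin 2) F (t - 1)) :=
  (polyRep p F).subrepresentation (MvPolynomial.homogeneousSubmodule (Fin 2) F (t - 1)) (by
    intro g f hf
    have hf' : f.IsHomogeneous (t - 1) := hf
    have : (subst p F g.unop f).IsHomogeneous (1 * (t - 1)) := by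
      refine hf'.aeval _ fun i => ?_
      refine MvPolynomial.IsHomogeneous.sum _ _ _ fun j _ => ?_
      simpa using (MvPolynomial.isHomogeneous_C (Fin 2) (incl p F (g.unop i j))).mul
        (MvPolynomial.isHomogeneous_X F j)
    rw [one_mul] at this
    exact this)

section Green

variable {p F} {W : Type*} [AddCommGroup W] [Module F W]

/-- Restriction from `G` to the upper triangular group. -/
abbrev res (ρ : Representation F (G p)ᵐᵒᵖ W) : Representation F (Bop p) W :=
  ρ.comp (Bop p).subtype

/-- Induction from the upper triangular group to `G`. -/
abbrev ind (σ : Representation F (Bop p) W) :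
    Representation F (G p)ᵐᵒᵖ (Representation.IndV (Bop p).subtype σ) :=
  Representation.ind (Bop p).subtype σ

/-- `ρ` is the Green correspondent of `σ`: both are indecomposable and not projective, the
restriction of `ρ` is the direct sum of `σ` and a projective module, and the module induced from
`σ` is the direct sum of `ρ` and a projective module. -/
structure IsGreenCorrespondent {W' : Type*} [AddCommGroup W'] [Module F W']
    (ρ : Representation F (G p)ᵐᵒᵖ W) (σ : Representation F (Bop p) W') : Prop where
  indecomposable : IsIndecomposable F[(G p)ᵐᵒᵖ] ρ.asModule
  not_projective : ¬ Module.Projective F[(G p)ᵐᵒᵖ] ρ.asModule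
  indecomposable' : IsIndecomposable F[Bop p] σ.asModule
  not_projective' : ¬ Module.Projective F[Bop p] σ.asModule
  res_eq : IsSumProjective F[Bop p] (res ρ).asModule σ.asModule
  ind_eq : IsSumProjective F[(G p)ᵐᵒᵖ] (ind σ).asModule ρ.asModule

end Green

end SLTwo

end

open scoped MonoidAlgebra MatrixGroups

noncomputable section

namespace SLTwo

/-! ### Submodules of a non-split extension of two simple modules -/

section Extensions

variable {A : Type*} [Ring A] {M : Type*} [AddCommGroup M] [Module A M]

/-! The induced module is realised as the space `homFun` of functions on the plane over the prime
field that vanish at 0 and satisfy f(cv) = c^a f(v). A function of this kind is determined by one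
value on each of the p + 1 lines, and the function supported on the line of `e₁` spans the copy of
S_a that generates (`indEquiv`).

Two equivariant maps describe this space. Evaluation of forms of degree a (`formToFun`) maps V_{a+1}
into it. The transform f ↦ ∑ f(v) det(v, (x, y))^m with m = p - a - 1 (`funToForm`) maps it to
V_{p-a}. The composite only involves power sums ∑ v₀^i v₁^j with i + j = p - 1 < 2(p - 1); one
exponent is below p - 1, so they vanish. For t ≤ p the module V_t is simple: a nonzero submodule
contains y^{t-1}, and this generates. Hence the first map is injective and the second surjective as
soon as they are nonzero, and (a + 1) + (p - a) = p + 1 makes the sequence exact.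

A homomorphism from the induced module to V_t is determined by the image of the generator, a vector
fixed by the upper unitriangular matrices, hence a multiple of a power of y. So every homomorphism
to V_{a+1} is a multiple of the transform with m = a (`exists_eq_smul_transform`). If a ≠ 0 it kills
V_{a+1}, again because 2a < 2(p - 1). The extension is therefore non-split, so V_{a+1} is its only
proper nonzero submodule.

Over B, the value at `e₁` splits off S_a, and the functions vanishing at `e₁` form a projective
module by Higman's criterion (`sum_restrictLine`). The same criterion shows that S_a and its induced
module are not projective. Any Green correspondent is a nonzero summand of the indecomposable
induced module, hence all of it. -/

/-- An extension of a simple module by a simple module has these two composition factors. -/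
theorem hasCompositionFactors_of_extension (N : Fin 2 → Type*) [∀ i, AddCommGroup (N i)]
    [∀ i, Module A (N i)] [IsSimpleModule A (N 0)] [IsSimpleModule A (N 1)]
    (ι : N 0 →ₗ[A] M) (π : M →ₗ[A] N 1) (hι : Function.Injective ι)
    (hπ : Function.Surjective π) (hex : LinearMap.range ι = LinearMap.ker π) :
    HasCompositionFactors A M N := by
  have h₁ : (⊥ : Submodule A M) ⋖ LinearMap.range ι := by
    rw [bot_covBy_iff, ← isSimpleModule_iff_isAtom]
    exact IsSimpleModule.congr (LinearEquiv.ofInjective ι hι).symm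
  have h₂ : LinearMap.range ι ⋖ (⊤ : Submodule A M) := by
    rw [covBy_top_iff, ← isSimpleModule_iff_isCoatom, hex]
    exact IsSimpleModule.congr (π.quotKerEquivOfSurjective hπ)
  let s : CompositionSeries (Submodule A M) :=
    { length := 2
      toFun := ![⊥, LinearMap.range ι, ⊤]
      step := by
        intro i
        fin_cases i
        · exact h₁
        · exact h₂ }
  have hs : s.head = ⊥ := rfl
  have hs' : s.last = ⊤ := rfl
  refine ⟨⟨s, hs, hs'⟩, fun t ht ht' => ?_⟩
  obtain ⟨e, he⟩ := CompositionSeries.jordan_holder t s (ht.trans hs.symm) (ht'.trans hs'.symm)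
  have key : ∀ j : Fin 2,
      Nonempty ((s j.succ ⧸ (s j.castSucc).submoduleOf (s j.succ)) ≃ₗ[A] N j) := by
    intro j
    fin_cases j
    · have e₁ : (LinearMap.range ι ⧸ (⊥ : Submodule A M).submoduleOf (LinearMap.range ι)) ≃ₗ[A]
          N 0 :=
        (Submodule.quotEquivOfEqBot _ (by simp [Submodule.submoduleOf])).trans
          (LinearEquiv.ofInjective ι hι).symm
      exact ⟨e₁⟩
    · have e₂ : ((⊤ : Submodule A M) ⧸ (LinearMap.range ι).submoduleOf ⊤) ≃ₗ[A] N 1 :=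
        (Submodule.Quotient.equiv _ (LinearMap.ker π) Submodule.topEquiv (by
          rw [hex]; ext x; simp [Submodule.submoduleOf])).trans
          (π.quotKerEquivOfSurjective hπ)
      exact ⟨e₂⟩
  exact ⟨e, fun i => ⟨(he i).linearEquiv.trans (key (e i)).some⟩⟩

variable {V₁ V₂ : Type*} [AddCommGroup V₁] [Module A V₁] [AddCommGroup V₂] [Module A V₂]
  [IsSimpleModule A V₁] [IsSimpleModule A V₂]
  (ι : V₁ →ₗ[A] M) (π : M →ₗ[A] V₂)

/-- In a non-split extension of simple modules, the only proper nonzero submodule is the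
kernel of the extension. -/
theorem eq_range_of_nonsplit_extension (hι : Function.Injective ι) (hπ : Function.Surjective π)
    (hex : LinearMap.range ι = LinearMap.ker π) (hns : ∀ θ : M →ₗ[A] V₁, θ ∘ₗ ι = 0)
    (N : Submodule A M) : N = ⊥ ∨ N = LinearMap.range ι ∨ N = ⊤ := by
  have hatom : IsAtom (LinearMap.range ι) := by
    rw [← isSimpleModule_iff_isAtom]
    exact IsSimpleModule.congr (LinearEquiv.ofInjective ι hι).symm
  have hcoatom : IsCoatom (LinearMap.range ι) := by
    rw [← isSimpleModule_iff_isCoatom, hex]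
    exact IsSimpleModule.congr (π.quotKerEquivOfSurjective hπ)
  by_cases hle : LinearMap.range ι ≤ N
  · exact Or.inr (hcoatom.le_iff.1 hle).symm
  · have hd : Disjoint (LinearMap.range ι) N := hatom.not_le_iff_disjoint.1 hle
    left
    by_contra hN
    have hsup : LinearMap.range ι ⊔ N = ⊤ := by
      refine hcoatom.2 _ (lt_of_le_of_ne le_sup_left fun h => hN ?_)
      have : N ≤ LinearMap.range ι := by rw [h]; exact le_sup_right
      exact hd.symm.eq_bot_of_le this
    -- A complement of the image would give a projection back to `V₁`, a homomorphism that does not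
    -- vanish on the image.
    have hc : IsCompl (LinearMap.range ι) N := ⟨hd, codisjoint_iff.2 hsup⟩
    have := IsSimpleModule.nontrivial A V₁
    obtain ⟨v, hv⟩ := exists_ne (0 : V₁)
    have h0 := LinearMap.congr_fun (hns ((LinearEquiv.ofInjective ι hι).symm.toLinearMap ∘ₗ
      Submodule.projectionOnto _ _ hc)) v
    have h1 : Submodule.projectionOnto _ _ hc (ι v) = LinearEquiv.ofInjective ι hι v :=
      Submodule.projectionOnto_apply_left hc (LinearEquiv.ofInjective ι hι v)
    simp [h1] at h0
    exact hv h0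

theorem isUniserial_of_nonsplit_extension (hι : Function.Injective ι)
    (hπ : Function.Surjective π) (hex : LinearMap.range ι = LinearMap.ker π)
    (hns : ∀ θ : M →ₗ[A] V₁, θ ∘ₗ ι = 0) : IsUniserial A M := by
  intro N N'
  rcases eq_range_of_nonsplit_extension ι π hι hπ hex hns N with rfl | rfl | rfl
  · exact Or.inl bot_le
  · rcases eq_range_of_nonsplit_extension ι π hι hπ hex hns N' with rfl | rfl | rfl
    · exact Or.inr bot_le
    · exact Or.inl le_rfl
    · exact Or.inl le_top
  · exact Or.inr le_top

theorem nontrivial_of_injective (hι : Function.Injective ι) : Nontrivial M := by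
  have := IsSimpleModule.nontrivial A V₁
  exact hι.nontrivial

theorem socle_eq_range_of_nonsplit_extension (hι : Function.Injective ι)
    (hπ : Function.Surjective π) (hex : LinearMap.range ι = LinearMap.ker π)
    (hns : ∀ θ : M →ₗ[A] V₁, θ ∘ₗ ι = 0) : socle A M = LinearMap.range ι := by
  have hatom : IsAtom (LinearMap.range ι) := by
    rw [← isSimpleModule_iff_isAtom]
    exact IsSimpleModule.congr (LinearEquiv.ofInjective ι hι).symm
  have hcoatom : IsCoatom (LinearMap.range ι) := by
    rw [← isSimpleModule_iff_isCoatom, hex]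
    exact IsSimpleModule.congr (π.quotKerEquivOfSurjective hπ)
  refine le_antisymm (sSup_le fun N hN => ?_) (le_sSup (isSimpleModule_iff_isAtom.2 hatom))
  have hN' : IsAtom N := isSimpleModule_iff_isAtom.1 hN
  rcases eq_range_of_nonsplit_extension ι π hι hπ hex hns N with rfl | rfl | rfl
  · exact bot_le
  · exact le_rfl
  · exact absurd (hN'.2 _ hcoatom.lt_top) hatom.1

theorem jacobson_eq_ker_of_nonsplit_extension (hι : Function.Injective ι)
    (hπ : Function.Surjective π) (hex : LinearMap.range ι = LinearMap.ker π)
    (hns : ∀ θ : M →ₗ[A] V₁, θ ∘ₗ ι = 0) : Module.jacobson A M = LinearMap.ker π := by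
  have hatom : IsAtom (LinearMap.range ι) := by
    rw [← isSimpleModule_iff_isAtom]
    exact IsSimpleModule.congr (LinearEquiv.ofInjective ι hι).symm
  have hcoatom : IsCoatom (LinearMap.range ι) := by
    rw [← isSimpleModule_iff_isCoatom, hex]
    exact IsSimpleModule.congr (π.quotKerEquivOfSurjective hπ)
  rw [← hex]
  refine le_antisymm (sInf_le hcoatom) (le_sInf fun N (hN : IsCoatom N) => ?_)
  rcases eq_range_of_nonsplit_extension ι π hι hπ hex hns N with rfl | rfl | rfl
  · exact absurd (hN.2 _ hatom.bot_lt) hcoatom.1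
  · exact le_rfl
  · exact le_top

end Extensions

/-! ### Direct sum decompositions with a projective summand -/

section Decompositions

variable {A : Type*} [Ring A] {M : Type*} [AddCommGroup M] [Module A M]

theorem IsUniserial.isIndecomposable [Nontrivial M] (h : IsUniserial A M) :
    IsIndecomposable A M := by
  refine ⟨inferInstance, fun N N' hc => ?_⟩
  rcases h N N' with hle | hle
  · exact Or.inl (hc.disjoint.eq_bot_of_le hle)
  · exact Or.inr (hc.disjoint.symm.eq_bot_of_le hle)

theorem isUniserial_of_isSimpleModule [IsSimpleModule A M] : IsUniserial A M := by
  intro N N'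
  rcases eq_bot_or_eq_top N with rfl | rfl
  · exact Or.inl bot_le
  · exact Or.inr le_top

variable {N : Type*} [AddCommGroup N] [Module A N]

/-- A nonzero module which is a summand of an indecomposable module is isomorphic to it. -/
theorem IsSumProjective.nonempty_linearEquiv [Nontrivial N] (hM : IsIndecomposable A M)
    (h : IsSumProjective A M N) : Nonempty (N ≃ₗ[A] M) := by
  obtain ⟨N', P, hc, ⟨e⟩, -⟩ := h
  rcases hM.2 N' P hc with rfl | rfl
  · have : Nontrivial (⊥ : Submodule A M) := e.toEquiv.nontrivial
    exact absurd this (not_nontrivial _)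
  · have : N' = ⊤ := by simpa using hc.sup_eq_top
    subst this
    exact ⟨e.symm.trans Submodule.topEquiv⟩

theorem isSumProjective_self (e : M ≃ₗ[A] N) : IsSumProjective A M N :=
  ⟨⊤, ⊥, isCompl_top_bot, ⟨Submodule.topEquiv.trans e⟩, inferInstance⟩

theorem isSumProjective_of_retraction (i : N →ₗ[A] M) (q : M →ₗ[A] N) (hqi : ∀ n, q (i n) = n)
    (hP : Module.Projective A (LinearMap.ker q)) : IsSumProjective A M N := by
  have hinj : Function.Injective i := Function.LeftInverse.injective hqi
  refine ⟨LinearMap.range i, LinearMap.ker q, ?_, ⟨(LinearEquiv.ofInjective i hinj).symm⟩, hP⟩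
  exact LinearMap.isCompl_of_proj (f := (LinearEquiv.ofInjective i hinj).toLinearMap ∘ₗ q) (by
    rintro ⟨_, n, rfl⟩
    ext
    simp [hqi]) |> fun h => by rwa [LinearEquiv.ker_comp] at h

theorem IsSumProjective.of_linearEquiv {M' : Type*} [AddCommGroup M'] [Module A M']
    (h : IsSumProjective A M N) (e : M' ≃ₗ[A] M) : IsSumProjective A M' N := by
  obtain ⟨N', P, hc, ⟨e'⟩, hP⟩ := h
  refine ⟨N'.comap e.toLinearMap, P.comap e.toLinearMap, ?_, ⟨(e.ofSubmodule' N').trans e'⟩,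
    Module.Projective.of_equiv (e.ofSubmodule' P).symm⟩
  exact (Submodule.orderIsoMapComap e).symm.isCompl hc

end Decompositions

/-! ### Higman's criterion and non-projectivity in characteristic `p` -/

section Averaging

open MonoidAlgebra

variable {k : Type*} [Field k] {H : Type*} [Group H] [Fintype H]
  {M : Type*} [AddCommGroup M] [Module k[H] M]

/-- One half of the Higman criterion. -/
theorem projective_of_sum_conjugates_eq [Module k M] [IsScalarTower k k[H] M] (θ : M →ₗ[k] M)
    (h : ∀ m : M, ∑ g : H, single g⁻¹ (1 : k) • θ (single g (1 : k) • m) = m) :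
    Module.Projective k[H] M := by
  let L : (M →₀ k[H]) →ₗ[k[H]] M := Finsupp.linearCombination k[H] id
  have hL : Function.Surjective L := Finsupp.linearCombination_id_surjective k[H] M
  obtain ⟨s, hs⟩ := (L.restrictScalars k).exists_rightInverse_of_surjective
    (LinearMap.range_eq_top.2 hL)
  -- The conjugates of `s ∘ₗ θ` add up to an equivariant map; followed by the equivariant `L` it
  -- becomes the sum of conjugates of `θ`, the identity. So `M` is a summand of a free module.
  refine Module.Projective.of_split ((s ∘ₗ θ).sumOfConjugatesEquivariant H) L ?_
  ext m
  have hs' : ∀ x, L (s x) = x := fun x => LinearMap.congr_fun hs x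
  simp [LinearMap.sumOfConjugatesEquivariant_apply, LinearMap.conjugate_apply, hs', h]

/-- The other half of the Higman criterion. -/
theorem exists_sum_conjugates_eq [Module.Projective k[H] M] :
    ∃ θ : M → M, ∀ m : M, ∑ g : H, single g (1 : k) • θ (single g⁻¹ (1 : k) • m) = m := by
  obtain ⟨s, hs⟩ := Module.projective_def.1 ‹Module.Projective k[H] M›
  -- On the group algebra, projection to the coefficient at 1 has the identity as its sum of
  -- conjugates. The general case applies it coordinatewise to a splitting from a free module.
  let E : k[H] →+ k[H] :=
    { toFun := fun x => single 1 (x.coeff 1)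
      map_zero' := by simp
      map_add' := by simp }
  have hE : ∀ x : k[H], ∑ g : H, single g (1 : k) * E (single g⁻¹ (1 : k) * x) = x := by
    classical
    intro x
    ext h
    simp [E, coeff_sum]
  refine ⟨fun m => Finsupp.linearCombination k[H] id (Finsupp.mapRange.addMonoidHom E (s m)),
    fun m => ?_⟩
  conv_rhs => rw [← hs m]
  simp only [← map_smul, ← map_sum]
  congr 1
  ext n : 1
  simpa [Finsupp.finsetSum_apply] using hE (s m n)

/-- In characteristic `p`, a function on a finite group invariant under right translation by an
element of order `p` has sum zero. -/
theorem sum_eq_zero_of_mul_right_invariant {p : ℕ} [CharP k p] (u : H) (hu : orderOf u = p)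
    (f : H → k) (hf : ∀ g, f (g * u) = f g) : ∑ g, f g = 0 := by
  classical
  have hz : ∀ (n : ℕ) (g : H), f (g * u ^ n) = f g := by
    intro n
    induction n with
    | zero => simp
    | succ n ih => intro g; rw [pow_succ, ← mul_assoc, hf, ih]
  have hrel : ∀ g h : H, QuotientGroup.leftRel (Subgroup.zpowers u) g h → f g = f h := by
    intro g h hgh
    rw [QuotientGroup.leftRel_apply] at hgh
    obtain ⟨n, hn⟩ := mem_powers_iff_mem_zpowers.2 hgh
    rw [← hz n g]
    simp only at hn
    rw [hn, mul_inv_cancel_left]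
  let F : H ⧸ Subgroup.zpowers u → k := Quotient.lift f hrel
  have hF : ∀ g : H, f g = F (QuotientGroup.mk g) := fun g => rfl
  simp only [hF]
  rw [Finset.sum_comp F (QuotientGroup.mk : H → H ⧸ Subgroup.zpowers u)]
  refine Finset.sum_eq_zero fun q _ => ?_
  -- The function is constant on the left cosets of the subgroup generated by `u`, and each has `p`
  -- elements.
  have hcard : (Finset.univ.filter fun g : H =>
      (QuotientGroup.mk g : H ⧸ Subgroup.zpowers u) = q).card = p := by
    have h := QuotientGroup.card_preimage_mk (Subgroup.zpowers u) {q}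
    simp only [Nat.card_zpowers, hu, Nat.card_unique, mul_one] at h
    rw [← h, Nat.card_eq_fintype_card, Fintype.card_subtype]
    congr 1
    ext g
    simp
  rw [hcard, nsmul_eq_mul, CharP.cast_eq_zero, zero_mul]

/-- A projective module in characteristic `p` has no invariant vector under an element of order `p`
on which an invariant functional takes the value `1`. -/
theorem not_projective_of_invariant {p : ℕ} [CharP k p] (u : H) (hu : orderOf u = p)
    (m : M) (hm : single u (1 : k) • m = m) (φ : M →+ k)
    (hφ : ∀ x, φ (single u (1 : k) • x) = φ x) (h1 : φ m = 1) : ¬ Module.Projective k[H] M := by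
  intro hP
  obtain ⟨θ, hθ⟩ := exists_sum_conjugates_eq (k := k) (H := H) (M := M)
  have hsum := congrArg φ (hθ m)
  -- After g ↦ g⁻¹ the summand is φ(g⁻¹ θ(g m)). Replacing g by gu changes nothing: u fixes m, and φ
  -- absorbs the u⁻¹ on the left.
  rw [map_sum, ← Equiv.sum_comp (Equiv.inv H)] at hsum
  rw [h1, sum_eq_zero_of_mul_right_invariant u hu] at hsum
  · exact zero_ne_one hsum
  intro g
  have hm' : single u⁻¹ (1 : k) • m = m := by
    conv_lhs => rw [← hm]
    simp [smul_smul, single_mul_single, ← one_def]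
  have e₁ : single (g * u) (1 : k) • m = single g (1 : k) • m := by
    conv_rhs => rw [← hm]
    simp [smul_smul, single_mul_single]
  simp only [Equiv.inv_apply, inv_inv, e₁]
  rw [← hφ]
  simp [smul_smul, single_mul_single]

end Averaging

/-! ### Extracting coefficients from values on the prime field -/

section Extraction

variable {p : ℕ} [Fact p.Prime] {F : Type*} [Field F] [CharP F p]

/-- The coefficients of a polynomial of degree less than `p` are linear combinations of
its values at the elements of the prime field. -/
theorem coeff_mem_of_forall_sum_mem {W : Type*} [AddCommGroup W] [Module F W]
    (N : Submodule F W) {n : ℕ} (hn : n < p) (m : ℕ → W)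
    (h : ∀ β : ZMod p, ∑ k ∈ Finset.range (n + 1), (incl p F β) ^ k • m k ∈ N)
    {k : ℕ} (hk : k ≤ n) : m k ∈ N := by
  -- Functionals on the quotient reduce the claim to scalars: a polynomial of degree less than `p`
  -- with `p` roots is zero.
  rw [← Submodule.Quotient.mk_eq_zero, ← Module.forall_dual_apply_eq_zero_iff F]
  intro φ
  let P : Polynomial F := ∑ k ∈ Finset.range (n + 1),
    Polynomial.C (φ (Submodule.Quotient.mk (m k))) * Polynomial.X ^ k
  have hdeg : P.natDegree < Fintype.card (ZMod p) := by
    rw [ZMod.card]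
    refine lt_of_le_of_lt (Polynomial.natDegree_sum_le_of_forall_le _ _ fun i hi => ?_) hn
    exact (Polynomial.natDegree_C_mul_X_pow_le _ _).trans
      (Nat.lt_succ_iff.1 (Finset.mem_range.1 hi))
  have hP : P = 0 := by
    refine Polynomial.eq_zero_of_natDegree_lt_card_of_eval_eq_zero P
      (incl p F).injective (fun β => ?_) hdeg
    have := congrArg φ ((Submodule.Quotient.mk_eq_zero N).2 (h β))
    rw [← Submodule.mkQ_apply] at this
    simp only [map_sum, map_smul, map_zero, Submodule.mkQ_apply, smul_eq_mul] at this
    simp only [P, Polynomial.eval_finsetSum, Polynomial.eval_mul, Polynomial.eval_C,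
      Polynomial.eval_pow, Polynomial.eval_X]
    rw [← this]
    exact Finset.sum_congr rfl fun i _ => mul_comm _ _
  have := congrArg (fun Q => Polynomial.coeff Q k) hP
  simpa [P, Polynomial.finsetSum_coeff, Polynomial.coeff_C_mul, Polynomial.coeff_X_pow,
    Nat.lt_succ_iff.2 hk] using this

end Extraction

/-! ### Binary forms and their dimension -/

section BinaryForms

open MvPolynomial

variable {F : Type*} [Field F]

/-- The binary form of degree `n` with given coefficients. -/
def binaryForm (n : ℕ) (c : ℕ → F) : MvPolynomial (Fin 2) F :=
  ∑ i ∈ Finset.range (n + 1), c i • (X 0 ^ i * X 1 ^ (n - i))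

theorem binaryForm_congr {n : ℕ} {c c' : ℕ → F} (h : ∀ i ≤ n, c i = c' i) :
    binaryForm n c = binaryForm n c' :=
  Finset.sum_congr rfl fun i hi => by rw [h i (Nat.lt_succ_iff.1 (Finset.mem_range.1 hi))]

theorem X_pow_mul_X_pow_eq_monomial (i j : ℕ) :
    (X 0 ^ i * X 1 ^ j : MvPolynomial (Fin 2) F) =
      monomial (Finsupp.single 0 i + Finsupp.single 1 j) 1 := by
  simp [X_pow_eq_monomial, monomial_mul]

theorem finsupp_fin_two_eq (d : Fin 2 →₀ ℕ) :
    d = Finsupp.single 0 (d 0) + Finsupp.single 1 (d 1) := by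
  ext i
  fin_cases i <;> simp

theorem coeff_X_pow_mul_X_pow (i j : ℕ) (d : Fin 2 →₀ ℕ) :
    coeff d (X 0 ^ i * X 1 ^ j : MvPolynomial (Fin 2) F) = if i = d 0 ∧ j = d 1 then 1 else 0 := by
  classical
  rw [X_pow_mul_X_pow_eq_monomial, coeff_monomial]
  congr 1
  refine propext ⟨fun h => by simp [← h], fun h => ?_⟩
  conv_rhs => rw [finsupp_fin_two_eq d]
  rw [h.1, h.2]

theorem isHomogeneous_X_pow_mul_X_pow {n i : ℕ} (hi : i ≤ n) :
    (X 0 ^ i * X 1 ^ (n - i) : MvPolynomial (Fin 2) F).IsHomogeneous n := by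
  have := (isHomogeneous_X_pow (R := F) (0 : Fin 2) i).mul (isHomogeneous_X_pow (1 : Fin 2) (n - i))
  rwa [Nat.add_sub_cancel' hi] at this

theorem isHomogeneous_binaryForm (n : ℕ) (c : ℕ → F) : (binaryForm n c).IsHomogeneous n :=
  (homogeneousSubmodule (Fin 2) F n).sum_mem fun _ hi =>
    (homogeneousSubmodule (Fin 2) F n).smul_mem _
      (isHomogeneous_X_pow_mul_X_pow (Nat.lt_succ_iff.1 (Finset.mem_range.1 hi)))

theorem coeff_binaryForm {n i : ℕ} (c : ℕ → F) (hi : i ≤ n) :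
    coeff (Finsupp.single 0 i + Finsupp.single 1 (n - i)) (binaryForm n c) = c i := by
  simp only [binaryForm, coeff_sum, coeff_smul, coeff_X_pow_mul_X_pow]
  rw [Finset.sum_eq_single i]
  · simp
  · intro j _ hj
    simp [hj]
  · intro h
    exact absurd (Finset.mem_range.2 (Nat.lt_succ_iff.2 hi)) h

theorem eq_binaryForm {n : ℕ} {f : MvPolynomial (Fin 2) F} (hf : f.IsHomogeneous n) :
    f = binaryForm n fun i => coeff (Finsupp.single 0 i + Finsupp.single 1 (n - i)) f := by
  ext d
  by_cases hd : d 0 + d 1 = n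
  · have hd' : d = Finsupp.single 0 (d 0) + Finsupp.single 1 (n - d 0) := by
      conv_lhs => rw [finsupp_fin_two_eq d]
      congr 2
      omega
    rw [hd', coeff_binaryForm _ (by simpa using by omega)]
  · have hdeg : d.degree ≠ n := by
      rwa [Finsupp.degree_eq_sum, Fin.sum_univ_two]
    rw [hf.coeff_eq_zero hdeg, (isHomogeneous_binaryForm n _).coeff_eq_zero hdeg]

theorem X_pow_ne_zero (n : ℕ) : (X 1 ^ n : MvPolynomial (Fin 2) F) ≠ 0 :=
  pow_ne_zero _ (X_ne_zero _)

/-- The space of binary forms of degree `n` has dimension `n + 1`. -/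
theorem finrank_homogeneousSubmodule (n : ℕ) :
    Module.finrank F (homogeneousSubmodule (Fin 2) F n) = n + 1 := by
  have e : (Fin (n + 1) → F) ≃ₗ[F] homogeneousSubmodule (Fin 2) F n :=
    LinearEquiv.symm
    { toFun := fun f i => coeff (Finsupp.single 0 (i : ℕ) + Finsupp.single 1 (n - i)) f.1
      map_add' := fun f g => by ext i; simp
      map_smul' := fun c f => by ext i; simp
      invFun := fun c => ⟨binaryForm n fun i => if h : i < n + 1 then c ⟨i, h⟩ else 0,
        isHomogeneous_binaryForm _ _⟩
      left_inv := by
        rintro ⟨f, hf⟩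
        ext1
        refine Eq.trans ?_ (eq_binaryForm (F := F) (n := n) (f := f) hf).symm
        exact binaryForm_congr fun i hi => dif_pos (Nat.lt_succ_iff.2 hi)
      right_inv := by
        intro c
        ext i
        exact (coeff_binaryForm _ (Nat.lt_succ_iff.1 i.2)).trans (dif_pos i.2) }
  rw [← e.finrank_eq]
  simp

end BinaryForms

/-! ### Simplicity of `V t` and its unitriangular invariants -/

section Simple

open MvPolynomial

variable {p : ℕ} [Fact p.Prime] {F : Type*} [Field F] [CharP F p]

/-- The matrix `(1 β; 0 1)`. -/
def upper (β : ZMod p) : G p := ⟨!![1, β; 0, 1], by simp [Matrix.det_fin_two]⟩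

/-- The matrix `(1 0; γ 1)`. -/
def lower (γ : ZMod p) : G p := ⟨!![1, 0; γ, 1], by simp [Matrix.det_fin_two]⟩

theorem subst_X (g : G p) (i : Fin 2) :
    subst p F g (X i) = C (incl p F (g i 0)) * X 0 + C (incl p F (g i 1)) * X 1 := by
  simp [subst, Fin.sum_univ_two]

theorem subst_upper_X_zero (β : ZMod p) :
    subst p F (upper β) (X 0) = incl p F β • X 1 + X 0 := by
  rw [subst_X]; simp [upper, smul_eq_C_mul, add_comm]

theorem subst_upper_X_one (β : ZMod p) : subst p F (upper β) (X 1) = X 1 := by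
  rw [subst_X]; simp [upper]

theorem subst_lower_X_one (γ : ZMod p) :
    subst p F (lower γ) (X 1) = incl p F γ • X 0 + X 1 := by
  rw [subst_X]; simp [lower, smul_eq_C_mul]

/-- The coefficient of `β ^ k` in the image of a binary form under `(1 β; 0 1)`. -/
def shiftCoeff (n : ℕ) (c : ℕ → F) (k : ℕ) : MvPolynomial (Fin 2) F :=
  ∑ i ∈ Finset.range (n + 1), (c i * (i.choose k : F)) • (X 1 ^ k * X 0 ^ (i - k) * X 1 ^ (n - i))

/-- Binomial expansion of (x + βy)^i, sorted by powers of β. The inner sum may run up to `n` for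
every i because the extra binomial coefficients vanish. -/
theorem subst_upper_binaryForm (n : ℕ) (c : ℕ → F) (β : ZMod p) :
    subst p F (upper β) (binaryForm n c) =
      ∑ k ∈ Finset.range (n + 1), (incl p F β) ^ k • shiftCoeff n c k := by
  simp only [binaryForm, shiftCoeff, map_sum, map_smul, map_mul, map_pow, subst_upper_X_zero,
    subst_upper_X_one, Finset.smul_sum]
  rw [Finset.sum_comm]
  refine Finset.sum_congr rfl fun i hi => ?_
  rw [add_pow, Finset.sum_mul, Finset.smul_sum]
  refine Finset.sum_subset_zero_on_sdiff ?_ ?_ ?_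
  · exact Finset.range_subset_range.2 (Finset.mem_range.1 hi)
  · intro k hk
    have : i < k := by
      simp only [Finset.mem_sdiff, Finset.mem_range] at hk
      omega
    simp [Nat.choose_eq_zero_of_lt this]
  · intro k _
    simp only [smul_eq_C_mul, map_mul, map_pow, map_natCast]
    ring

/-- The coefficient extracted at the degree of a binary form in `x` is a power of `y`. -/
theorem shiftCoeff_eq {n d : ℕ} (c : ℕ → F) (hd : d ≤ n) (hc : ∀ i, d < i → i ≤ n → c i = 0) :
    shiftCoeff n c d = c d • X 1 ^ n := by
  rw [shiftCoeff, Finset.sum_eq_single d]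
  · simp [← pow_add, Nat.add_sub_cancel' hd]
  · intro i hi hid
    rcases lt_or_gt_of_ne hid with h | h
    · simp [Nat.choose_eq_zero_of_lt h]
    · simp [hc i h (Nat.lt_succ_iff.1 (Finset.mem_range.1 hi))]
  · intro h
    exact absurd (Finset.mem_range.2 (Nat.lt_succ_iff.2 hd)) h

theorem exists_leading_index {n : ℕ} {c : ℕ → F} (h : binaryForm n c ≠ 0) :
    ∃ d ≤ n, c d ≠ 0 ∧ ∀ i, d < i → i ≤ n → c i = 0 := by
  classical
  let s := (Finset.range (n + 1)).filter fun i => c i ≠ 0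
  have hs : s.Nonempty := by
    by_contra hs
    rw [Finset.not_nonempty_iff_eq_empty, Finset.filter_eq_empty_iff] at hs
    refine h (Finset.sum_eq_zero fun i hi => ?_)
    rw [not_not.1 (hs hi), zero_smul]
  have hmem := s.max'_mem hs
  obtain ⟨h₁, h₂⟩ := Finset.mem_filter.1 hmem
  refine ⟨s.max' hs, Nat.lt_succ_iff.1 (Finset.mem_range.1 h₁), h₂, fun i hi hin => ?_⟩
  by_contra hci
  have : i ∈ s := by simp [s, hci]; omega
  exact absurd (s.le_max' i this) (not_le.2 hi)

/-- A nonzero subspace of binary forms of degree less than `p`, closed under the upper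
unitriangular substitutions, contains a power of `y`. -/
theorem X_pow_mem_of_closed {n : ℕ} (hn : n < p) (N : Submodule F (MvPolynomial (Fin 2) F))
    (hN : ∀ β : ZMod p, ∀ f ∈ N, subst p F (upper β) f ∈ N)
    {f : MvPolynomial (Fin 2) F} (hf : f.IsHomogeneous n) (hfN : f ∈ N) (hf0 : f ≠ 0) :
    X 1 ^ n ∈ N := by
  rw [eq_binaryForm hf] at hfN hf0
  obtain ⟨d, hd, hcd, hc⟩ := exists_leading_index hf0
  have hmem := coeff_mem_of_forall_sum_mem N hn _
    (fun β => by rw [← subst_upper_binaryForm]; exact hN β _ hfN) hd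
  rw [shiftCoeff_eq _ hd hc] at hmem
  exact (N.smul_mem_iff hcd).1 hmem

/-- A binary form of degree less than `p` invariant under the upper unitriangular substitutions is
a multiple of a power of `y`. -/
theorem eq_smul_X_pow_of_invariant {n : ℕ} (hn : n < p) {f : MvPolynomial (Fin 2) F}
    (hf : f.IsHomogeneous n) (hinv : ∀ β : ZMod p, subst p F (upper β) f = f) :
    ∃ c : F, f = c • X 1 ^ n := by
  by_cases hf0 : f = 0
  · exact ⟨0, by simp [hf0]⟩
  set c : ℕ → F := fun i => coeff (Finsupp.single 0 i + Finsupp.single 1 (n - i)) f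
  have hfc : f = binaryForm n c := eq_binaryForm hf
  obtain ⟨d, hd, hcd, hc⟩ := exists_leading_index (hfc ▸ hf0)
  rcases Nat.eq_zero_or_pos d with rfl | hpos
  · refine ⟨c 0, ?_⟩
    rw [← shiftCoeff_eq c hd hc, hfc]
    -- At β = 0 only the term k = 0 of the expansion survives, so the form equals its own
    -- coefficient at k = 0.
    have := subst_upper_binaryForm n c (0 : ZMod p)
    rw [← hfc, hinv, Finset.sum_range_succ'] at this
    simpa [← hfc] using this
  · exfalso
    -- The difference between the translate of `f` and `f` is a polynomial in β vanishing on the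
    -- prime field. Its coefficient at `d` > 0 is `c d` times a power of y, which is nonzero.
    have hmem := coeff_mem_of_forall_sum_mem (p := p) (⊥ : Submodule F (MvPolynomial (Fin 2) F)) hn
      (fun k => shiftCoeff n c k - if k = 0 then f else 0) (fun β => by
        simp only [smul_sub, Finset.sum_sub_distrib]
        rw [← subst_upper_binaryForm, ← hfc, hinv]
        simp) hd
    simp only [hpos.ne', if_false, sub_zero, Submodule.mem_bot] at hmem
    rw [shiftCoeff_eq c hd hc, smul_eq_zero] at hmem
    exact hmem.elim hcd (X_pow_ne_zero n)

/-- The power of `y` generates the binary forms of degree less than `p` under the lower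
unitriangular substitutions. -/
theorem homogeneousSubmodule_le_of_closed {n : ℕ} (hn : n < p)
    (N : Submodule F (MvPolynomial (Fin 2) F))
    (hN : ∀ γ : ZMod p, ∀ f ∈ N, subst p F (lower γ) f ∈ N) (h : X 1 ^ n ∈ N) :
    homogeneousSubmodule (Fin 2) F n ≤ N := by
  intro f hf
  rw [eq_binaryForm (F := F) (n := n) (f := f) hf]
  refine N.sum_mem fun i hi => N.smul_mem _ ?_
  have hi' := Nat.lt_succ_iff.1 (Finset.mem_range.1 hi)
  have hmem := coeff_mem_of_forall_sum_mem (p := p) N hn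
    (fun k => (n.choose k : F) • (X 0 ^ k * X 1 ^ (n - k))) (fun γ => by
      have := hN γ _ h
      rw [map_pow, subst_lower_X_one, add_pow] at this
      convert this using 2 with k hk
      simp only [smul_eq_C_mul, map_pow, map_natCast]
      ring) hi'
  refine (N.smul_mem_iff ?_).1 hmem
  -- The binomial coefficient is invertible: it divides `n.factorial`, and `n` < `p`.
  intro h0
  rw [CharP.cast_eq_zero_iff F p] at h0
  have hdvd : p ∣ n.factorial := by
    rw [← Nat.choose_mul_factorial_mul_factorial hi', mul_assoc]
    exact h0.mul_right _
  exact absurd (((Fact.out : p.Prime).dvd_factorial).1 hdvd) (not_le.2 hn)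

theorem V_apply (t : ℕ) (g : (G p)ᵐᵒᵖ) (f : homogeneousSubmodule (Fin 2) F (t - 1)) :
    (V p F t g f : MvPolynomial (Fin 2) F) = subst p F g.unop f := rfl

/-- The upper unitriangular matrices force a power of y into every nonzero submodule, and the lower
ones generate everything from it. -/
theorem isIrreducible_V {t : ℕ} (ht : t - 1 < p) : (V p F t).IsIrreducible := by
  have key : ∀ N : Subrepresentation (V p F t),
      N = ⊥ ∨ N = ⊤ := by
    intro N
    let N' : Submodule F (MvPolynomial (Fin 2) F) := N.toSubmodule.map (Submodule.subtype _)
    have hN' : ∀ g : G p, ∀ f ∈ N', subst p F g f ∈ N' := by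
      rintro g _ ⟨f, hf, rfl⟩
      exact ⟨V p F t (MulOpposite.op g) f, N.apply_mem_toSubmodule _ hf, rfl⟩
    by_cases hN : ∃ f ∈ N.toSubmodule, f ≠ 0
    · right
      obtain ⟨f, hfN, hf0⟩ := hN
      have hle := homogeneousSubmodule_le_of_closed ht N' (fun γ => hN' (lower γ))
        (X_pow_mem_of_closed ht N' (fun β => hN' (upper β)) (f := f) f.2 ⟨f, hfN, rfl⟩
          (fun h => hf0 (Subtype.ext h)))
      refine SetLike.ext fun x => ⟨fun _ => trivial, fun _ => ?_⟩
      obtain ⟨y, hy, hyx⟩ := hle x.2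
      rwa [← show y = x from Subtype.ext hyx]
    · left
      push Not at hN
      refine SetLike.ext fun x => ⟨fun hx => hN x hx, fun hx => ?_⟩
      rw [show x = 0 from hx]
      exact N.toSubmodule.zero_mem
  have : Nontrivial (Subrepresentation (V p F t)) := by
    refine ⟨⊥, ⊤, fun h => ?_⟩
    have hmem : (⟨X 1 ^ (t - 1), isHomogeneous_X_pow _ _⟩ :
        homogeneousSubmodule (Fin 2) F (t - 1)) ∈ (⊥ : Subrepresentation (V p F t)) := by
      rw [h]; trivial
    exact X_pow_ne_zero (F := F) (t - 1) (congrArg Subtype.val hmem)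
  exact ⟨key⟩

end Simple

/-! ### The induced module as homogeneous functions on the plane -/

section FunctionModel

open MvPolynomial

variable {p : ℕ} [Fact p.Prime] {F : Type*} [Field F]

/-- The plane over the prime field. -/
abbrev Plane (p : ℕ) : Type := Fin 2 → ZMod p

/-- The action of a matrix on the plane of column vectors. -/
def actEquiv (g : G p) : Plane p ≃ Plane p where
  toFun v := (g : Matrix (Fin 2) (Fin 2) (ZMod p)).mulVec v
  invFun v := ((g⁻¹ : G p) : Matrix (Fin 2) (Fin 2) (ZMod p)).mulVec v
  left_inv v := by
    simp only [Matrix.mulVec_mulVec, ← Matrix.SpecialLinearGroup.coe_mul, inv_mul_cancel,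
      Matrix.SpecialLinearGroup.coe_one, Matrix.one_mulVec]
  right_inv v := by
    simp only [Matrix.mulVec_mulVec, ← Matrix.SpecialLinearGroup.coe_mul, mul_inv_cancel,
      Matrix.SpecialLinearGroup.coe_one, Matrix.one_mulVec]

theorem actEquiv_eq_mulVec (g : G p) (v : Plane p) :
    actEquiv g v = (g : Matrix (Fin 2) (Fin 2) (ZMod p)).mulVec v := rfl

theorem actEquiv_apply (g : G p) (v : Plane p) (i : Fin 2) :
    actEquiv g v i = g i 0 * v 0 + g i 1 * v 1 := by
  rw [actEquiv_eq_mulVec, Matrix.mulVec, dotProduct, Fin.sum_univ_two]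

theorem actEquiv_mul (g h : G p) (v : Plane p) :
    actEquiv (g * h) v = actEquiv g (actEquiv h v) := by
  rw [actEquiv_eq_mulVec, actEquiv_eq_mulVec, actEquiv_eq_mulVec, Matrix.mulVec_mulVec,
    Matrix.SpecialLinearGroup.coe_mul]

@[simp]
theorem actEquiv_one (v : Plane p) : actEquiv (1 : G p) v = v := by
  simp [actEquiv_eq_mulVec]

@[simp]
theorem actEquiv_zero (g : G p) : actEquiv g 0 = 0 := by
  simp [actEquiv_eq_mulVec]

theorem actEquiv_smul (g : G p) (c : ZMod p) (v : Plane p) :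
    actEquiv g (c • v) = c • actEquiv g v := by
  rw [actEquiv_eq_mulVec, actEquiv_eq_mulVec, Matrix.mulVec_smul]

@[simp]
theorem actEquiv_inv_apply (g : G p) (v : Plane p) : actEquiv g⁻¹ (actEquiv g v) = v := by
  rw [← actEquiv_mul]; simp

@[simp]
theorem actEquiv_apply_inv (g : G p) (v : Plane p) : actEquiv g (actEquiv g⁻¹ v) = v := by
  rw [← actEquiv_mul]; simp

theorem actEquiv_eq_zero_iff (g : G p) (v : Plane p) : actEquiv g v = 0 ↔ v = 0 := by
  rw [← actEquiv_zero g, (actEquiv g).injective.eq_iff, actEquiv_zero]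

variable (p F) in
/-- The right module of functions on the plane. -/
def funRep : Representation F (G p)ᵐᵒᵖ (Plane p → F) where
  toFun g := LinearMap.funLeft F F (actEquiv g.unop)
  map_one' := by
    ext
    simp [LinearMap.funLeft_apply]
  map_mul' g h := LinearMap.ext fun f => funext fun v => by
    simp [LinearMap.funLeft_apply, actEquiv_mul]

theorem funRep_apply (g : (G p)ᵐᵒᵖ) (f : Plane p → F) (v : Plane p) :
    funRep p F g f v = f (actEquiv g.unop v) := rfl

variable [CharP F p]

variable (p F) in
/-- The functions on the plane which are homogeneous of degree `a` and vanish at the origin. -/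
def homFun (a : ℕ) : Submodule F (Plane p → F) where
  carrier := {f | f 0 = 0 ∧ ∀ (c : (ZMod p)ˣ) (v : Plane p),
    f ((c : ZMod p) • v) = incl p F c ^ a * f v}
  zero_mem' := by simp
  add_mem' := by
    rintro f g ⟨hf, hf'⟩ ⟨hg, hg'⟩
    refine ⟨by simp [hf, hg], fun c v => ?_⟩
    rw [Pi.add_apply, hf', hg', Pi.add_apply, mul_add]
  smul_mem' := by
    rintro r f ⟨hf, hf'⟩
    refine ⟨by simp [hf], fun c v => ?_⟩
    rw [Pi.smul_apply, hf', Pi.smul_apply, smul_eq_mul, smul_eq_mul, mul_left_comm]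

variable (p F) in
/-- The right module of homogeneous functions on the plane. -/
def homRep (a : ℕ) : Representation F (G p)ᵐᵒᵖ (homFun p F a) :=
  (funRep p F).subrepresentation (homFun p F a) (by
    rintro g f ⟨hf, hf'⟩
    refine ⟨by simp [funRep_apply, hf], fun c v => ?_⟩
    rw [funRep_apply, actEquiv_smul, hf', funRep_apply])

theorem homRep_apply (a : ℕ) (g : (G p)ᵐᵒᵖ) (f : homFun p F a) (v : Plane p) :
    (homRep p F a g f).1 v = f.1 (actEquiv g.unop v) := rfl

/-- The group of units has p - 1 elements, which is -1 in `F`. This is the source of the minus signs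
below: a sum over vectors counts each line -1 times. -/
theorem sum_units_const {W : Type*} [AddCommGroup W] [Module F W] (w : W) :
    ∑ _c : (ZMod p)ˣ, w = -w := by
  rw [Finset.sum_const, Finset.card_univ, ZMod.card_units, ← Nat.cast_smul_eq_nsmul F,
    Nat.cast_sub (Fact.out : p.Prime).one_le]
  simp

variable (F) in
/-- The homogeneous function of degree `a` supported on the line through `v`, with value `1`
at `v`. -/
def lineFun (a : ℕ) (v : Plane p) : Plane p → F := fun w =>
  ∑ c : (ZMod p)ˣ, if w = (c : ZMod p) • v then incl p F c ^ a else 0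

theorem sum_lineFun_smul {W : Type*} [AddCommGroup W] [Module F W] (a : ℕ) (v : Plane p)
    (x : Plane p → W) :
    ∑ w, lineFun F a v w • x w = ∑ c : (ZMod p)ˣ, incl p F c ^ a • x ((c : ZMod p) • v) := by
  simp only [lineFun, Finset.sum_smul, ite_smul, zero_smul]
  rw [Finset.sum_comm]
  exact Finset.sum_congr rfl fun c _ => by simp

theorem lineFun_mem (a : ℕ) {v : Plane p} (hv : v ≠ 0) : lineFun F a v ∈ homFun p F a := by
  refine ⟨Finset.sum_eq_zero fun c _ => if_neg fun h => ?_, fun c w => ?_⟩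
  · exact hv ((smul_eq_zero.1 h.symm).resolve_left c.ne_zero)
  · rw [lineFun, lineFun, Finset.mul_sum, ← Equiv.sum_comp (Equiv.mulLeft c)]
    refine Finset.sum_congr rfl fun d _ => ?_
    have : (c : ZMod p) • w = ((Equiv.mulLeft c d : (ZMod p)ˣ) : ZMod p) • v ↔
        w = (d : ZMod p) • v := by
      simp [mul_smul, (smul_right_injective (Plane p) c.ne_zero).eq_iff]
    simp only [this, mul_ite, mul_zero]
    simp [mul_pow]

theorem lineFun_self (a : ℕ) {v : Plane p} (hv : v ≠ 0) : lineFun F a v v = 1 := by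
  rw [lineFun, Finset.sum_eq_single 1]
  · simp
  · intro c _ hc
    refine if_neg fun h => hc ?_
    have : ((1 : ZMod p) - c) • v = 0 := by rw [sub_smul, one_smul, ← h, sub_self]
    have := (smul_eq_zero.1 this).resolve_right hv
    exact Units.ext (sub_eq_zero.1 this).symm
  · simp

theorem funRep_lineFun (a : ℕ) (g : G p) (v : Plane p) :
    funRep p F (MulOpposite.op g) (lineFun F a v) = lineFun F a (actEquiv g⁻¹ v) := by
  ext w
  rw [funRep_apply, lineFun, lineFun]
  refine Finset.sum_congr rfl fun c _ => if_congr ?_ rfl rfl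
  rw [← actEquiv_smul, MulOpposite.unop_op]
  constructor
  · intro h; rw [← h]; simp
  · rintro rfl; simp

theorem lineFun_smul (a : ℕ) (c : (ZMod p)ˣ) (v : Plane p) :
    incl p F c ^ a • lineFun F a ((c : ZMod p) • v) = lineFun F a v := by
  ext w
  rw [Pi.smul_apply, lineFun, lineFun, Finset.smul_sum]
  conv_rhs => rw [← Equiv.sum_comp (Equiv.mulRight c)]
  refine Finset.sum_congr rfl fun d _ => ?_
  simp [smul_smul, mul_pow, mul_comm]

/-- A homogeneous function is a combination of functions supported on lines. -/
theorem sum_smul_lineFun {a : ℕ} {f : Plane p → F} (hf : f ∈ homFun p F a) :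
    ∑ v, f v • lineFun F a v = -f := by
  ext w
  have h : ∀ v, f v * lineFun F a v w =
      ∑ c : (ZMod p)ˣ, if v = ((c⁻¹ : (ZMod p)ˣ) : ZMod p) • w then f w else 0 := by
    intro v
    rw [lineFun, Finset.mul_sum]
    refine Finset.sum_congr rfl fun c _ => ?_
    by_cases hw : w = (c : ZMod p) • v
    · have hv : v = ((c⁻¹ : (ZMod p)ˣ) : ZMod p) • w := by
        rw [hw, smul_smul, Units.inv_mul, one_smul]
      rw [if_pos hw, if_pos hv, hw, hf.2, mul_comm]
    · have hv : ¬ v = ((c⁻¹ : (ZMod p)ˣ) : ZMod p) • w := by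
        rintro rfl
        exact hw (by rw [smul_smul, Units.mul_inv, one_smul])
      rw [if_neg hw, if_neg hv, mul_zero]
  simp only [Finset.sum_apply, Pi.smul_apply, smul_eq_mul, h, Pi.neg_apply]
  rw [Finset.sum_comm, ← sum_units_const (p := p) (F := F) (f w)]
  exact Finset.sum_congr rfl fun c _ => by
    rw [Finset.sum_ite_eq' Finset.univ, if_pos (Finset.mem_univ _)]

/-- The first basis vector. -/
def e₁ : Plane p := ![1, 0]

theorem e₁_ne_zero : (e₁ : Plane p) ≠ 0 := fun h => by
  simpa [e₁] using congrFun h 0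

theorem actEquiv_e₁_ne_zero (g : G p) : actEquiv g e₁ ≠ 0 := by
  rw [Ne, actEquiv_eq_zero_iff]
  exact e₁_ne_zero

/-- The element of `G` with given entries. -/
def ofEntries (α β γ δ : ZMod p) (h : α * δ - β * γ = 1) : G p :=
  ⟨!![α, β; γ, δ], by simp [Matrix.det_fin_two, h]⟩

theorem actEquiv_ofEntries_e₁ (α β γ δ : ZMod p) (h : α * δ - β * γ = 1) :
    actEquiv (ofEntries α β γ δ h) e₁ = ![α, γ] := by
  ext i
  rw [actEquiv_apply]
  fin_cases i <;> simp [e₁, ofEntries]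

theorem exists_actEquiv_e₁ {v : Plane p} (hv : v ≠ 0) : ∃ g : G p, actEquiv g e₁ = v := by
  by_cases h0 : v 0 = 0
  · have h1 : v 1 ≠ 0 := fun h1 => hv (by ext i; fin_cases i <;> simp [h0, h1])
    refine ⟨ofEntries 0 (-(v 1)⁻¹) (v 1) 0 (by simp [h1]), ?_⟩
    rw [actEquiv_ofEntries_e₁]
    ext i
    fin_cases i <;> simp [h0]
  · refine ⟨ofEntries (v 0) 0 (v 1) (v 0)⁻¹ (by simp [h0]), ?_⟩
    rw [actEquiv_ofEntries_e₁]
    ext i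
    fin_cases i <;> simp

theorem actEquiv_upper_e₁ (β : ZMod p) : actEquiv (upper β) e₁ = e₁ := by
  ext i
  rw [actEquiv_apply]
  fin_cases i <;> simp [upper, e₁]

/-- A matrix which maps the first basis vector to its multiple by `c` is upper triangular with
upper left entry `c`. -/
theorem entries_of_actEquiv_e₁ {b : G p} {c : ZMod p} (h : actEquiv b e₁ = c • e₁) :
    b 0 0 = c ∧ b 1 0 = 0 := by
  constructor
  · have := congrFun h 0
    rw [actEquiv_apply] at this
    simpa [e₁] using this
  · have := congrFun h 1
    rw [actEquiv_apply] at this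
    simpa [e₁] using this

theorem actEquiv_e₁_of_borel {b : G p} (h : b 1 0 = 0) : actEquiv b e₁ = b 0 0 • e₁ := by
  ext i
  rw [actEquiv_apply]
  fin_cases i <;> simp [e₁, h]

theorem borel_entry_ne_zero {b : G p} (h : b 1 0 = 0) : b 0 0 ≠ 0 := by
  intro h0
  have := b.2
  rw [Matrix.det_fin_two] at this
  simp [h0, h] at this

variable (F) in
/-- The generator of the homogeneous functions, translated by `g`. -/
def colFun (a : ℕ) (g : G p) : homFun p F a :=
  ⟨lineFun F a (actEquiv g e₁), lineFun_mem a (actEquiv_e₁_ne_zero g)⟩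

theorem homRep_colFun (a : ℕ) (g h : G p) :
    homRep p F a (MulOpposite.op h) (colFun F a g) = colFun F a (h⁻¹ * g) := by
  apply Subtype.ext
  refine (funRep_lineFun a h (actEquiv g e₁)).trans ?_
  rw [← actEquiv_mul]
  rfl

theorem S_apply (a : ℕ) (b : Bop p) (x : F) :
    S p F a b x = incl p F (b.1.unop 0 0) ^ a * x := by
  simp [S]

/-- Right multiplication by `B` only rescales the first column. This is the relation that lets
`indToFun` factor through the coinvariants. -/
theorem colFun_mul_borel (a : ℕ) (b : Bop p) (g : G p) :
    incl p F (b.1.unop 0 0) ^ a • colFun F a (g * b.1.unop) = colFun F a g := by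
  have hb : b.1.unop 1 0 = 0 := b.2
  apply Subtype.ext
  have := lineFun_smul (F := F) a (Units.mk0 _ (borel_entry_ne_zero hb)) (actEquiv g e₁)
  rw [Units.val_mk0, ← actEquiv_smul, ← actEquiv_e₁_of_borel hb, ← actEquiv_mul] at this
  exact this

variable (p F) in
/-- The map from the induced module to homogeneous functions. -/
def indToFun (a : ℕ) : Representation.IndV (Bop p).subtype (S p F a) →ₗ[F] homFun p F a :=
  Representation.Coinvariants.lift _
    (TensorProduct.lift <| (Finsupp.lift _ _ _ fun h : (G p)ᵐᵒᵖ =>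
        LinearMap.toSpanSingleton F _ (colFun F a h.unop)) ∘ₗ
      (MonoidAlgebra.coeffLinearEquiv F).toLinearMap)
    fun b => by
      ext h
      simp [Representation.ofMulAction_single]
      rw [S_apply]
      exact congrFun (congrArg Subtype.val (colFun_mul_borel a b h.unop)) _

theorem indToFun_mk (a : ℕ) (h : (G p)ᵐᵒᵖ) (x : F) :
    indToFun p F a (Representation.IndV.mk _ _ h x) = x • colFun F a h.unop := by
  simp [indToFun]

/-- A matrix with prescribed first column. -/
def colMatrix (v : Plane p) : G p := if hv : v ≠ 0 then (exists_actEquiv_e₁ hv).choose else 1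

theorem actEquiv_colMatrix {v : Plane p} (hv : v ≠ 0) : actEquiv (colMatrix v) e₁ = v := by
  rw [colMatrix, dif_pos hv]
  exact (exists_actEquiv_e₁ hv).choose_spec

variable (p F) in
/-- The map from homogeneous functions to the induced module. -/
def funToInd (a : ℕ) : homFun p F a →ₗ[F] Representation.IndV (Bop p).subtype (S p F a) :=
  -- Summing over vectors avoids choosing a representative of each line; the sign corrects the
  -- multiplicity p - 1 = -1. The arbitrary matrix chosen at `v = 0` is harmless because the
  -- functions vanish there.
  -∑ v, (LinearMap.proj v ∘ₗ (homFun p F a).subtype).smulRight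
    (Representation.IndV.mk (Bop p).subtype (S p F a) (MulOpposite.op (colMatrix v)) 1)

theorem funToInd_apply (a : ℕ) (f : homFun p F a) :
    funToInd p F a f = -∑ v, f.1 v • Representation.IndV.mk (Bop p).subtype (S p F a)
      (MulOpposite.op (colMatrix v)) 1 := by
  rw [funToInd, LinearMap.neg_apply, LinearMap.sum_apply]
  rfl

theorem sum_smul_colFun (a : ℕ) (f : homFun p F a) :
    ∑ v, f.1 v • colFun F a (colMatrix v) = -f := by
  apply Subtype.ext
  rw [Submodule.coe_neg, ← sum_smul_lineFun f.2, Submodule.coe_sum]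
  refine Finset.sum_congr rfl fun v _ => ?_
  by_cases hv : v = 0
  · simp [hv, f.2.1]
  · exact congrArg (fun w => f.1 v • lineFun F a w) (actEquiv_colMatrix hv)

/-- Two matrices whose first columns are proportional differ by an element of `B`, so this is the
defining relation of the coinvariants. -/
theorem mk_eq_of_actEquiv (a : ℕ) {g g' : G p} {c : ZMod p}
    (h : actEquiv g' e₁ = c • actEquiv g e₁) :
    incl p F c ^ a • Representation.IndV.mk (Bop p).subtype (S p F a) (MulOpposite.op g') 1 =
      Representation.IndV.mk (Bop p).subtype (S p F a) (MulOpposite.op g) 1 := by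
  have hb : actEquiv (g⁻¹ * g') e₁ = c • e₁ := by
    rw [actEquiv_mul, h, actEquiv_smul, actEquiv_inv_apply]
  obtain ⟨h00, h10⟩ := entries_of_actEquiv_e₁ hb
  let b : Bop p := ⟨MulOpposite.op (g⁻¹ * g'), h10⟩
  have := Representation.Coinvariants.mk_self_apply
    (Representation.tprod ((Representation.leftRegular F (G p)ᵐᵒᵖ).comp (Bop p).subtype) (S p F a))
    b (MonoidAlgebra.single (MulOpposite.op g) 1 ⊗ₜ 1)
  have hmul : (b : (G p)ᵐᵒᵖ) * MulOpposite.op g = MulOpposite.op g' := by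
    simp [b, ← MulOpposite.op_mul]
  have hS : S p F a b 1 = incl p F c ^ a • (1 : F) := by
    rw [S_apply, smul_eq_mul]
    simp only [b, MulOpposite.unop_op, h00]
  simp only [Representation.tprod_apply, TensorProduct.map_tmul, MonoidHom.comp_apply,
    Subgroup.coe_subtype, Representation.ofMulAction_single, smul_eq_mul, hmul, hS] at this
  rw [← map_smul]
  exact this

theorem indToFun_funToInd (a : ℕ) (f : homFun p F a) : indToFun p F a (funToInd p F a f) = f := by
  rw [funToInd_apply, map_neg, map_sum]
  simp only [map_smul, indToFun_mk, one_smul, MulOpposite.unop_op]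
  rw [sum_smul_colFun, neg_neg]

theorem funToInd_colFun (a : ℕ) (g : G p) :
    funToInd p F a (colFun F a g) =
      Representation.IndV.mk (Bop p).subtype (S p F a) (MulOpposite.op g) 1 := by
  rw [funToInd_apply, colFun, sum_lineFun_smul, neg_eq_iff_eq_neg,
    ← sum_units_const (p := p) (F := F)]
  refine Finset.sum_congr rfl fun c _ => mk_eq_of_actEquiv a (actEquiv_colMatrix ?_)
  exact smul_ne_zero c.ne_zero (actEquiv_e₁_ne_zero g)

theorem funToInd_indToFun (a : ℕ) : funToInd p F a ∘ₗ indToFun p F a = LinearMap.id := by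
  refine Representation.IndV.hom_ext _ _ fun h => LinearMap.ext_ring ?_
  change funToInd p F a (indToFun p F a (Representation.IndV.mk _ _ h 1)) =
    Representation.IndV.mk _ _ h 1
  rw [indToFun_mk, one_smul, funToInd_colFun, MulOpposite.op_unop]

variable (p F) in
/-- The module induced from `S_a` is the module of homogeneous functions of degree `a`. -/
def indEquiv (a : ℕ) : (ind (S p F a)).Equiv (homRep p F a) :=
  Representation.Equiv.mk
    (LinearEquiv.ofLinearMap (indToFun p F a) (funToInd p F a)
      (LinearMap.ext (indToFun_funToInd a)) (funToInd_indToFun a))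
    fun g => by
      refine Representation.IndV.hom_ext _ _ fun h => LinearMap.ext_ring ?_
      change indToFun p F a (ind (S p F a) g (Representation.IndV.mk _ _ h 1)) =
        homRep p F a g (indToFun p F a (Representation.IndV.mk _ _ h 1))
      rw [Representation.ind_mk, indToFun_mk, indToFun_mk, one_smul, one_smul,
        ← MulOpposite.op_unop g, homRep_colFun]
      rfl

end FunctionModel

/-! ### Evaluation of forms and the transform back to forms -/

section Maps

open MvPolynomial

variable {p : ℕ} [Fact p.Prime] {F : Type*} [Field F] [CharP F p]

/-- The value of a polynomial at a point of the plane over the prime field. -/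
def evalAt (v : Plane p) : MvPolynomial (Fin 2) F →ₐ[F] F := aeval fun i => incl p F (v i)

theorem evalAt_subst (g : G p) (v : Plane p) (f : MvPolynomial (Fin 2) F) :
    evalAt v (subst p F g f) = evalAt (actEquiv g v) f := by
  have : (evalAt v).comp (subst p F g) = evalAt (F := F) (actEquiv g v) := by
    ext i
    simp only [AlgHom.comp_apply, subst_X, evalAt, map_add, map_mul, aeval_X, actEquiv_apply,
      algHom_C, Algebra.algebraMap_self, RingHom.id_apply]
  exact DFunLike.congr_fun this f

theorem evalAt_binaryForm (v : Plane p) (n : ℕ) (c : ℕ → F) :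
    evalAt v (binaryForm n c) = ∑ i ∈ Finset.range (n + 1),
      c i * (incl p F (v 0) ^ i * incl p F (v 1) ^ (n - i)) := by
  simp only [binaryForm, map_sum, map_smul, map_mul, map_pow, evalAt, aeval_X, smul_eq_mul]

theorem evalAt_smul {n : ℕ} {f : MvPolynomial (Fin 2) F} (hf : f.IsHomogeneous n) (c : ZMod p)
    (v : Plane p) : evalAt (c • v) f = incl p F c ^ n * evalAt v f := by
  rw [eq_binaryForm hf, evalAt_binaryForm, evalAt_binaryForm, Finset.mul_sum]
  refine Finset.sum_congr rfl fun i hi => ?_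
  have hi' : i ≤ n := Nat.lt_succ_iff.1 (Finset.mem_range.1 hi)
  conv_rhs => rw [← Nat.add_sub_cancel' hi', pow_add]
  simp only [Pi.smul_apply, smul_eq_mul, map_mul, mul_pow, Nat.add_sub_cancel_left]
  ring

variable (p F) in
/-- Binary forms as homogeneous functions. -/
def formToFun (a : ℕ) : (V p F (a + 1)).IntertwiningMap (homRep p F a) where
  toFun f := ⟨fun v => if v = 0 then 0 else evalAt v f.1, by
    refine ⟨if_pos rfl, fun c v => ?_⟩
    have : (c : ZMod p) • v = 0 ↔ v = 0 := by simp
    simp only [this, mul_ite, mul_zero]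
    rw [evalAt_smul (n := a) f.2]⟩
  map_add' f g := by
    ext v
    by_cases hv : v = 0 <;> simp [hv]
  map_smul' c f := by
    ext v
    by_cases hv : v = 0 <;> simp [hv]
  isIntertwining' g := by
    ext f v
    simp only [LinearMap.comp_apply, LinearMap.coe_mk, AddHom.coe_mk, homRep_apply,
      actEquiv_eq_zero_iff, V_apply, evalAt_subst]

theorem formToFun_apply (a : ℕ) (f : homogeneousSubmodule (Fin 2) F (a + 1 - 1)) (v : Plane p) :
    (formToFun p F a f).1 v = if v = 0 then 0 else evalAt v f.1 := rfl

variable (F) in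
/-- The linear form vanishing at `v`, given by the determinant. -/
def linForm (v : Plane p) : MvPolynomial (Fin 2) F :=
  C (incl p F (v 0)) * X 1 - C (incl p F (v 1)) * X 0

/-- The form is the determinant of `v` and the column (x, y). Substitution multiplies that column by
`g`, and `g` has determinant 1. -/
theorem subst_linForm (g : G p) (v : Plane p) :
    subst p F g (linForm F (actEquiv g v)) = linForm F v := by
  have hdet : g 0 0 * g 1 1 - g 0 1 * g 1 0 = 1 := by
    rw [← Matrix.det_fin_two]; exact g.2
  have hdet' : (C (incl p F (g 0 0)) * C (incl p F (g 1 1)) -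
      C (incl p F (g 0 1)) * C (incl p F (g 1 0)) : MvPolynomial (Fin 2) F) = 1 := by
    rw [← C_mul, ← C_mul, ← C_sub, ← map_mul, ← map_mul, ← map_sub, hdet, map_one, C_1]
  simp only [linForm, map_sub, map_mul, subst_X, algHom_C, actEquiv_apply, map_add,
    algebraMap_eq]
  linear_combination (C (incl p F (v 0)) * X 1 - C (incl p F (v 1)) * X 0) * hdet'

theorem linForm_smul (c : ZMod p) (v : Plane p) :
    linForm F (c • v) = incl p F c • linForm F v := by
  simp only [linForm, Pi.smul_apply, smul_eq_mul, map_mul, smul_eq_C_mul]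
  ring

theorem linForm_e₁ : linForm F (e₁ : Plane p) = X 1 := by
  simp [linForm, e₁]

@[simp]
theorem linForm_zero : linForm F (0 : Plane p) = 0 := by
  simp [linForm]

theorem isHomogeneous_linForm (v : Plane p) : (linForm F v).IsHomogeneous 1 := by
  refine IsHomogeneous.sub ?_ ?_
  · simpa using (isHomogeneous_C (Fin 2) (incl p F (v 0))).mul (isHomogeneous_X F 1)
  · simpa using (isHomogeneous_C (Fin 2) (incl p F (v 1))).mul (isHomogeneous_X F 0)

variable (F) in
/-- The transform of a function on the plane to a binary form. -/
def transform (m : ℕ) : (Plane p → F) →ₗ[F] MvPolynomial (Fin 2) F :=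
  ∑ v, (LinearMap.proj v).smulRight (linForm F v ^ m)

theorem transform_apply (m : ℕ) (f : Plane p → F) :
    transform F m f = ∑ v, f v • linForm F v ^ m := by
  rw [transform, LinearMap.sum_apply]
  rfl

theorem isHomogeneous_transform (m : ℕ) (f : Plane p → F) :
    (transform F m f).IsHomogeneous m := by
  rw [transform_apply]
  refine (homogeneousSubmodule (Fin 2) F m).sum_mem fun v _ =>
    (homogeneousSubmodule (Fin 2) F m).smul_mem _ ?_
  have := (isHomogeneous_linForm (F := F) v).pow m
  rwa [one_mul] at this

theorem transform_funRep (m : ℕ) (g : (G p)ᵐᵒᵖ) (f : Plane p → F) :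
    transform F m (funRep p F g f) = subst p F g.unop (transform F m f) := by
  rw [transform_apply, transform_apply, map_sum]
  conv_rhs => rw [← Equiv.sum_comp (actEquiv g.unop)]
  refine Finset.sum_congr rfl fun v _ => ?_
  rw [map_smul, map_pow, subst_linForm, funRep_apply]

variable (p F) in
/-- The transform as a homomorphism from homogeneous functions to binary forms. -/
def funToForm (a t : ℕ) : (homRep p F a).IntertwiningMap (V p F t) where
  toLinearMap := ((transform F (t - 1)).comp (homFun p F a).subtype).codRestrict _
    fun f => isHomogeneous_transform (t - 1) f.1
  isIntertwining' g := by
    ext1 f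
    exact Subtype.ext (transform_funRep (t - 1) g f.1)

theorem funToForm_apply (a t : ℕ) (f : homFun p F a) :
    (funToForm p F a t f).1 = transform F (t - 1) f.1 := rfl

theorem sum_incl_pow_eq_zero {i : ℕ} (hi : i < p - 1) : ∑ x : ZMod p, incl p F x ^ i = 0 := by
  have := FiniteField.sum_pow_lt_card_sub_one (ZMod p) i (by rwa [ZMod.card])
  simpa only [map_sum, map_pow, map_zero] using congrArg (incl p F) this

/-- Power sums over the plane vanish in small degree. -/
theorem sum_plane_pow_eq_zero {i j : ℕ} (h : i + j < 2 * (p - 1)) :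
    ∑ v : Plane p, incl p F (v 0) ^ i * incl p F (v 1) ^ j = 0 := by
  have h2 : ∑ v : Plane p, incl p F (v 0) ^ i * incl p F (v 1) ^ j =
      (∑ x : ZMod p, incl p F x ^ i) * ∑ y : ZMod p, incl p F y ^ j := by
    rw [← Equiv.sum_comp (finTwoArrowEquiv (ZMod p)).symm, Fintype.sum_prod_type,
      Finset.sum_mul_sum]
    simp [finTwoArrowEquiv]
  rw [h2]
  -- The sum factors over the two coordinates, and both exponents cannot reach p - 1.
  rcases lt_or_ge i (p - 1) with hi | hi
  · rw [sum_incl_pow_eq_zero hi, zero_mul]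
  · rw [sum_incl_pow_eq_zero (i := j) (by omega), mul_zero]

/-- The transform kills polynomial functions of small degree. -/
theorem transform_formToFun {a m : ℕ} (hm : m ≠ 0) (h : a + m < 2 * (p - 1))
    (f : homogeneousSubmodule (Fin 2) F (a + 1 - 1)) :
    transform F m (formToFun p F a f).1 = 0 := by
  -- For `a = 0` the function and the form differ at the origin; since `m ≠ 0` the factor `linForm F
  -- 0 ^ m` hides this.
  have hv : ∀ v : Plane p, (formToFun p F a f).1 v • linForm F v ^ m =
      evalAt v f.1 • linForm F v ^ m := by
    intro v
    rw [formToFun_apply]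
    by_cases hv : v = 0
    · simp [hv, hm]
    · rw [if_neg hv]
  have hf : f.1.IsHomogeneous a := f.2
  rw [transform_apply, Finset.sum_congr rfl fun v _ => hv v, eq_binaryForm hf]
  simp only [evalAt_binaryForm, Finset.sum_smul]
  rw [Finset.sum_comm]
  refine Finset.sum_eq_zero fun i hi => ?_
  have hi' : i ≤ a := Nat.lt_succ_iff.1 (Finset.mem_range.1 hi)
  simp only [linForm, sub_eq_add_neg, add_pow, Finset.smul_sum]
  rw [Finset.sum_comm]
  refine Finset.sum_eq_zero fun k hk => ?_
  have hk' : k ≤ m := Nat.lt_succ_iff.1 (Finset.mem_range.1 hk)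
  have hz := sum_plane_pow_eq_zero (p := p) (F := F) (i := i + k) (j := a - i + (m - k)) (by omega)
  have hz' : ∑ v : Plane p, C (incl p F (v 0) ^ (i + k) * incl p F (v 1) ^ (a - i + (m - k))) =
      (0 : MvPolynomial (Fin 2) F) := by
    rw [← map_sum, hz, C_0]
  set c := coeff (Finsupp.single 0 i + Finsupp.single 1 (a - i)) f.1
  refine Eq.trans ?_ ((congrArg (C c * X 1 ^ k * (-X 0) ^ (m - k) *
    (m.choose k : MvPolynomial (Fin 2) F) * ·) hz').trans (mul_zero _))
  rw [Finset.mul_sum]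
  refine Finset.sum_congr rfl fun v _ => ?_
  rw [← mul_neg, mul_pow, mul_pow]
  simp only [smul_eq_C_mul, map_mul, map_pow, pow_add]
  ring

theorem colFun_one_val (a : ℕ) : (colFun F a (1 : G p)).1 = lineFun F a e₁ := by
  simp [colFun]

theorem homRep_upper_colFun (a : ℕ) (β : ZMod p) :
    homRep p F a (MulOpposite.op (upper β)) (colFun F a 1) = colFun F a 1 := by
  apply Subtype.ext
  rw [colFun_one_val]
  refine (congrArg (funRep p F _) (colFun_one_val a)).trans ?_
  rw [funRep_lineFun]
  congr 1
  conv_lhs => rw [← actEquiv_upper_e₁ β]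
  exact actEquiv_inv_apply _ _

/-- Rescaling by c contributes c^(a + m) = c^(p - 1) = 1, so the p - 1 vectors of the line
contribute equally. The transform is thus nonzero. -/
theorem transform_lineFun {a m : ℕ} (h : a + m = p - 1) :
    transform F m (lineFun F a (e₁ : Plane p)) = -X 1 ^ m := by
  rw [transform_apply, sum_lineFun_smul, ← sum_units_const (p := p) (F := F)]
  refine Finset.sum_congr rfl fun c _ => ?_
  rw [linForm_smul, linForm_e₁, smul_pow, smul_smul, ← pow_add, h, ← map_pow,
    ← Units.val_pow_eq_pow_val, ZMod.units_pow_card_sub_one_eq_one]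
  simp

/-- A homomorphism from homogeneous functions to binary forms is a multiple of the transform. -/
theorem exists_eq_smul_transform {a t : ℕ} (ht : t - 1 < p)
    (θ : (homRep p F a).IntertwiningMap (V p F t)) :
    ∃ c : F, ∀ f : homFun p F a, (θ f).1 = c • transform F (t - 1) f.1 := by
  have hθ : ∀ (g : G p) (f : homFun p F a),
      (θ (homRep p F a (MulOpposite.op g) f)).1 = subst p F g (θ f).1 := fun g f => by
    rw [θ.isIntertwining, V_apply, MulOpposite.unop_op]
  obtain ⟨c, hc⟩ := eq_smul_X_pow_of_invariant ht (θ (colFun F a 1)).2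
    (fun β => by rw [← hθ, homRep_upper_colFun])
  -- Translating the generator determines the homomorphism on all `colFun`, which span.
  have hcol : ∀ g : G p, (θ (colFun F a g)).1 = c • linForm F (actEquiv g e₁) ^ (t - 1) := by
    intro g
    have h1 := homRep_colFun (F := F) a 1 g⁻¹
    rw [inv_inv, mul_one] at h1
    have h2 : subst p F g⁻¹ (X 1) = linForm F (actEquiv g e₁) := by
      rw [← linForm_e₁ (p := p) (F := F), ← subst_linForm g⁻¹ (actEquiv g e₁), actEquiv_inv_apply]
    rw [← h1, hθ, hc, map_smul, map_pow, h2]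
  refine ⟨-c, fun f => ?_⟩
  have hf : f = -∑ v, f.1 v • colFun F a (colMatrix v) := by rw [sum_smul_colFun, neg_neg]
  conv_lhs => rw [hf]
  rw [map_neg, map_sum, Submodule.coe_neg, Submodule.coe_sum, transform_apply, neg_smul,
    Finset.smul_sum]
  congr 1
  refine Finset.sum_congr rfl fun v _ => ?_
  rw [map_smul, Submodule.coe_smul, hcol, smul_comm]
  by_cases hv : v = 0
  · simp [hv, f.2.1]
  · rw [actEquiv_colMatrix hv]

/-- The vectors `e₁` and (x, 1) represent the p + 1 lines, and the values there determine the
function. The upper bound suffices for the exactness argument. -/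
theorem finrank_homFun_le (a : ℕ) : Module.finrank F (homFun p F a) ≤ p + 1 := by
  let ev : homFun p F a →ₗ[F] (Option (ZMod p) → F) :=
    LinearMap.pi fun o => (LinearMap.proj (o.elim e₁ fun x => ![x, 1])) ∘ₗ (homFun p F a).subtype
  have hev : Function.Injective ev := by
    rw [← LinearMap.ker_eq_bot, LinearMap.ker_eq_bot']
    intro f hf
    have h0 : f.1 e₁ = 0 := congrFun hf none
    have h1 : ∀ x : ZMod p, f.1 ![x, 1] = 0 := fun x => congrFun hf (some x)
    ext v
    change f.1 v = 0
    by_cases hv1 : v 1 = 0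
    · by_cases hv0 : v 0 = 0
      · rw [show v = 0 by ext i; fin_cases i <;> simp [hv0, hv1]]
        exact f.2.1
      · have hv : v = ((Units.mk0 _ hv0 : (ZMod p)ˣ) : ZMod p) • e₁ := by
          ext i; fin_cases i <;> simp [hv1, e₁]
        rw [hv, f.2.2, h0, mul_zero]
    · have hv : v = ((Units.mk0 _ hv1 : (ZMod p)ˣ) : ZMod p) • ![v 0 / v 1, 1] := by
        ext i; fin_cases i <;> simp [hv1, mul_div_cancel₀]
      rw [hv, f.2.2, h1, mul_zero]
  have := LinearMap.finrank_le_finrank_of_injective hev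
  rwa [Module.finrank_fintype_fun_eq_card, Fintype.card_option, ZMod.card] at this

end Maps

/-! ### From representations to modules over the group algebra -/

section AsModule

variable {k H : Type*} [Field k] [Group H] {V W : Type*} [AddCommGroup V] [Module k V]
  [AddCommGroup W] [Module k W] {ρ : Representation k H V} {σ : Representation k H W}

/-- An intertwining map as a linear map over the group algebra. -/
abbrev toModuleHom (f : ρ.IntertwiningMap σ) : ρ.asModule →ₗ[k[H]] σ.asModule :=
  Representation.IntertwiningMap.equivLinearMapAsModule ρ σ f

/-- An equivalence of representations as a linear equivalence over the group algebra. -/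
def toModuleEquiv (e : ρ.Equiv σ) : ρ.asModule ≃ₗ[k[H]] σ.asModule :=
  LinearEquiv.ofBijective (toModuleHom e.toIntertwiningMap) e.toLinearEquiv.bijective

theorem single_one_smul (h : H) (x : ρ.asModule) :
    MonoidAlgebra.single h (1 : k) • x = ρ h x := by
  rw [Representation.single_smul, one_smul]
  rfl

/-- A retraction of representations whose kernel satisfies the Higman criterion. -/
theorem isSumProjective_of_intertwining [Fintype H] (i : σ.IntertwiningMap ρ)
    (q : ρ.IntertwiningMap σ) (hqi : ∀ w, q (i w) = w) (θ : V →ₗ[k] V)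
    (hθ : ∀ v, q v = 0 → q (θ v) = 0) (h : ∀ v, q v = 0 → ∑ g : H, ρ g⁻¹ (θ (ρ g v)) = v) :
    IsSumProjective k[H] ρ.asModule σ.asModule := by
  refine isSumProjective_of_retraction (toModuleHom i) (toModuleHom q) hqi ?_
  let K := LinearMap.ker (toModuleHom q)
  let θ' : K →ₗ[k] K :=
    { toFun := fun f => ⟨θ f.1, hθ f.1 f.2⟩
      map_add' := fun f g => Subtype.ext (θ.map_add f.1 g.1)
      map_smul' := fun c f => Subtype.ext (θ.map_smul c f.1) }
  refine projective_of_sum_conjugates_eq (k := k) (M := K) θ' fun f => Subtype.ext ?_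
  rw [Submodule.coe_sum]
  refine Eq.trans (Finset.sum_congr rfl fun g _ => ?_) (h f.1 f.2)
  rw [Submodule.coe_smul, single_one_smul]
  exact congrArg (fun x => ρ g⁻¹ (θ x)) (single_one_smul g f.1)

variable {U : Type*} [AddCommGroup U] [Module k U] {τ : Representation k H U}

/-- The submodule structure of a non-split extension of irreducible representations. -/
theorem socle_and_top_of_nonsplit_extension {ι : ρ.IntertwiningMap σ} {π : σ.IntertwiningMap τ}
    [IsSimpleModule k[H] ρ.asModule] [IsSimpleModule k[H] τ.asModule]
    (hι : Function.Injective ι) (hπ : Function.Surjective π)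
    (hπι : ∀ x, π (ι x) = 0) (hex : ∀ y, π y = 0 → ∃ x, ι x = y)
    (hns : ∀ (θ : σ.IntertwiningMap ρ) (x : V), θ (ι x) = 0) :
    IsUniserial k[H] σ.asModule ∧ IsIndecomposable k[H] σ.asModule ∧
      Nonempty (socle k[H] σ.asModule ≃ₗ[k[H]] ρ.asModule) ∧
      Nonempty (Top k[H] σ.asModule ≃ₗ[k[H]] τ.asModule) := by
  obtain ⟨i, hi⟩ : ∃ i : ρ.asModule →ₗ[k[H]] σ.asModule, ∀ x, i x = ι x :=
    ⟨toModuleHom ι, fun _ => rfl⟩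
  obtain ⟨q, hq⟩ : ∃ q : σ.asModule →ₗ[k[H]] τ.asModule, ∀ x, q x = π x :=
    ⟨toModuleHom π, fun _ => rfl⟩
  have hinj : Function.Injective i := fun x y h => hι (by rwa [hi, hi] at h)
  have hsurj : Function.Surjective q := fun z => (hπ z).imp fun y hy => (hq y).trans hy
  have hex' : LinearMap.range i = LinearMap.ker q := by
    refine le_antisymm ?_ fun y hy => ?_
    · rintro _ ⟨x, rfl⟩
      rw [LinearMap.mem_ker, hq, hi]
      exact hπι x
    · exact (hex y ((hq y).symm.trans hy)).imp fun x hx => (hi x).trans hx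
  have hns' : ∀ θ : σ.asModule →ₗ[k[H]] ρ.asModule, θ ∘ₗ i = 0 := fun θ =>
    LinearMap.ext fun x => (congrArg θ (hi x)).trans
      (hns ((Representation.IntertwiningMap.equivLinearMapAsModule _ _).symm θ) x)
  have huni := isUniserial_of_nonsplit_extension i q hinj hsurj hex' hns'
  have := nontrivial_of_injective i hinj
  refine ⟨huni, huni.isIndecomposable, ?_, ?_⟩
  · rw [socle_eq_range_of_nonsplit_extension i q hinj hsurj hex' hns']
    exact ⟨(LinearEquiv.ofInjective i hinj).symm⟩
  · exact ⟨(Submodule.quotEquivOfEq _ _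
      (jacobson_eq_ker_of_nonsplit_extension i q hinj hsurj hex' hns')).trans
        (q.quotKerEquivOfSurjective hsurj)⟩

end AsModule

/-! ### Exactness and non-splitting -/

section Exactness

open MvPolynomial

variable {p : ℕ} [Fact p.Prime] {F : Type*} [Field F] [CharP F p]

/-- By simplicity it is enough that the map is nonzero: x^a has value 1 at `e₁`. -/
theorem formToFun_injective {a : ℕ} (ha : a < p) : Function.Injective (formToFun p F a) := by
  have := isIrreducible_V (p := p) (F := F) (t := a + 1) ha
  refine (Representation.IsIrreducible.injective_or_eq_zero (formToFun p F a)).resolve_right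
    fun h => ?_
  let x : homogeneousSubmodule (Fin 2) F (a + 1 - 1) := ⟨X 0 ^ a, isHomogeneous_X_pow _ _⟩
  have hx : (formToFun p F a x).1 e₁ = 0 := by rw [h]; rfl
  rw [formToFun_apply, if_neg e₁_ne_zero] at hx
  simp [x, evalAt, e₁] at hx

theorem funToForm_surjective {a : ℕ} (ha : a < p) :
    Function.Surjective (funToForm p F a (p - a)) := by
  have := isIrreducible_V (p := p) (F := F) (t := p - a) (by omega)
  refine (Representation.IsIrreducible.surjective_or_eq_zero
    (funToForm p F a (p - a))).resolve_right fun h => ?_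
  have hx : (funToForm p F a (p - a) (colFun F a 1)).1 = 0 := by rw [h]; rfl
  rw [funToForm_apply, colFun_one_val, transform_lineFun (by omega), neg_eq_zero] at hx
  exact X_pow_ne_zero _ hx

theorem funToForm_formToFun {a : ℕ} (ha : a ≤ p - 2) (hp : 2 ≤ p)
    (f : homogeneousSubmodule (Fin 2) F (a + 1 - 1)) :
    funToForm p F a (p - a) (formToFun p F a f) = 0 :=
  Subtype.ext (transform_formToFun (by omega) (by omega) f)

/-- Dimension count: the kernel has dimension at most (p + 1) - (p - a) = a + 1, already attained by
the image of the forms inside it. -/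
theorem mem_range_formToFun {a : ℕ} (ha : a ≤ p - 2) (hp : 2 ≤ p) {f : homFun p F a}
    (hf : funToForm p F a (p - a) f = 0) : ∃ x, formToFun p F a x = f := by
  have hfin : Module.Finite F (homFun p F a) := inferInstance
  have hle : LinearMap.range (formToFun p F a).toLinearMap ≤
      LinearMap.ker (funToForm p F a (p - a)).toLinearMap := by
    rintro _ ⟨x, rfl⟩
    exact funToForm_formToFun ha hp x
  have hrange : Module.finrank F (LinearMap.range (formToFun p F a).toLinearMap) = a + 1 := by
    rw [LinearMap.finrank_range_of_inj (formToFun_injective (by omega)),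
      finrank_homogeneousSubmodule, Nat.add_sub_cancel]
  have hker := LinearMap.finrank_range_add_finrank_ker (funToForm p F a (p - a)).toLinearMap
  have hsurj : Function.Surjective (funToForm p F a (p - a)).toLinearMap :=
    funToForm_surjective (by omega)
  rw [LinearMap.range_eq_top.2 hsurj, finrank_top, finrank_homogeneousSubmodule] at hker
  have hdim := finrank_homFun_le (p := p) (F := F) a
  have heq := Submodule.eq_of_le_of_finrank_le hle (by omega)
  have hmem : f ∈ LinearMap.ker (funToForm p F a (p - a)).toLinearMap := hf
  rw [← heq] at hmem
  exact hmem

/-- Here the transform has degree `a`, and a + a < 2(p - 1). For a = 0 the statement fails: the sum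
of the values sends the constant 1 off the origin to p² - 1 = -1. -/
theorem comp_formToFun_eq_zero {a : ℕ} (ha : a ≤ p - 2) (hp : 2 ≤ p) (ha0 : a ≠ 0)
    (θ : (homRep p F a).IntertwiningMap (V p F (a + 1)))
    (x : homogeneousSubmodule (Fin 2) F (a + 1 - 1)) : θ (formToFun p F a x) = 0 := by
  obtain ⟨c, hc⟩ := exists_eq_smul_transform (by omega) θ
  apply Subtype.ext
  refine (hc _).trans ?_
  have h0 : transform F (a + 1 - 1) (formToFun p F a x).1 = 0 :=
    transform_formToFun (m := a) ha0 (by omega) x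
  rw [h0, smul_zero]
  rfl

end Exactness

/-! ### Restriction to `B`, projectivity and the Green correspondence -/

section GreenCorrespondence

variable {p : ℕ} [Fact p.Prime] {F : Type*} [Field F]

variable (p F) in
/-- Minus the restriction of functions to the line spanned by the second basis vector. -/
def restrictLine : (Plane p → F) →ₗ[F] (Plane p → F) :=
  LinearMap.pi fun v => if v 0 = 0 then -LinearMap.proj v else 0

theorem restrictLine_apply (f : Plane p → F) (v : Plane p) :
    restrictLine p F f v = if v 0 = 0 then -f v else 0 := by
  rw [restrictLine, LinearMap.pi_apply]
  split_ifs <;> rfl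

variable [CharP F p]

theorem upper_mul_upper (β γ : ZMod p) : upper β * upper γ = upper (β + γ) := by
  ext i j
  rw [Matrix.SpecialLinearGroup.coe_mul, Matrix.mul_apply, Fin.sum_univ_two]
  fin_cases i <;> fin_cases j <;> simp [upper, add_comm]

theorem upper_zero : upper (0 : ZMod p) = 1 := by
  ext i j
  rw [Matrix.SpecialLinearGroup.coe_one]
  fin_cases i <;> fin_cases j <;> simp [upper]

theorem upper_one_pow (n : ℕ) : upper (1 : ZMod p) ^ n = upper (n : ZMod p) := by
  induction n with
  | zero => rw [pow_zero, Nat.cast_zero, upper_zero]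
  | succ n ih => rw [pow_succ, ih, upper_mul_upper, Nat.cast_succ]

theorem upper_one_ne_one : upper (1 : ZMod p) ≠ 1 := by
  intro h
  have h1 : (upper (1 : ZMod p)) 0 1 = (1 : G p) 0 1 := by rw [h]
  rw [Matrix.SpecialLinearGroup.coe_one] at h1
  simp [upper] at h1

theorem orderOf_op_upper_one : orderOf (MulOpposite.op (upper (1 : ZMod p))) = p := by
  refine orderOf_eq_prime ?_ ?_
  · rw [← MulOpposite.op_pow, upper_one_pow, CharP.cast_eq_zero, upper_zero, MulOpposite.op_one]
  · rw [Ne, MulOpposite.op_eq_one_iff]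
    exact upper_one_ne_one

instance finite_op : Finite (G p)ᵐᵒᵖ :=
  have : Finite (G p) := inferInstanceAs (Finite {A : Matrix (Fin 2) (Fin 2) (ZMod p) // A.det = 1})
  Finite.of_equiv (G p) MulOpposite.opEquiv

/-- The unitriangular element of order `p` fixes both the line function of `e₁` and evaluation at
`e₁`, and the latter takes the value 1 on the former. -/
theorem not_projective_homRep (a : ℕ) :
    ¬ Module.Projective F[(G p)ᵐᵒᵖ] (homRep p F a).asModule := by
  have : Fintype (G p)ᵐᵒᵖ := Fintype.ofFinite _
  let φ : homFun p F a →ₗ[F] F := LinearMap.proj e₁ ∘ₗ (homFun p F a).subtype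
  refine not_projective_of_invariant (p := p) (MulOpposite.op (upper 1)) ?_
    (M := (homRep p F a).asModule) (colFun F a 1) ?_ φ.toAddMonoidHom ?_ ?_
  · exact orderOf_op_upper_one
  · exact (single_one_smul (ρ := homRep p F a) _ _).trans (homRep_upper_colFun a 1)
  · intro x
    rw [single_one_smul]
    exact (homRep_apply a _ x e₁).trans
      (congrArg (Subtype.val x) (actEquiv_upper_e₁ 1))
  · exact (congrFun (colFun_one_val a) e₁).trans (lineFun_self a e₁_ne_zero)

theorem not_projective_S (a : ℕ) : ¬ Module.Projective F[Bop p] (S p F a).asModule := by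
  have : Fintype (Bop p) := Fintype.ofFinite _
  let u : Bop p := ⟨MulOpposite.op (upper 1), by
    change (upper (1 : ZMod p)) 1 0 = 0
    simp [upper]⟩
  have hu : ∀ x : F, S p F a u x = x := by
    intro x
    have h00 : (upper (1 : ZMod p)) 0 0 = 1 := by simp [upper]
    rw [S_apply]
    simp only [u, MulOpposite.unop_op, h00, map_one, one_pow, one_mul]
  refine not_projective_of_invariant (p := p) u ?_ (M := (S p F a).asModule) (1 : F) ?_
    (AddMonoidHom.id F) ?_ rfl
  · rw [← Subgroup.orderOf_coe]
    exact orderOf_op_upper_one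
  · exact (single_one_smul (ρ := S p F a) _ _).trans (hu 1)
  · intro x
    rw [single_one_smul]
    exact hu x

theorem isSimpleModule_S (a : ℕ) : IsSimpleModule F[Bop p] (S p F a).asModule := by
  rw [← Representation.irreducible_iff_isSimpleModule_asModule]
  have : Nontrivial (Subrepresentation (S p F a)) := by
    refine ⟨⊥, ⊤, fun h => ?_⟩
    have hmem : (1 : F) ∈ (⊥ : Subrepresentation (S p F a)) := by
      rw [h]; trivial
    exact one_ne_zero hmem
  refine ⟨fun N => ?_⟩
  rcases eq_bot_or_eq_top N.toSubmodule with h | h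
  · exact Or.inl (Subrepresentation.toSubmodule_injective h)
  · exact Or.inr (Subrepresentation.toSubmodule_injective h)

variable (p F) in
/-- The inclusion of `S_a` into the restriction of the homogeneous functions. -/
def inclS (a : ℕ) : (S p F a).IntertwiningMap (res (homRep p F a)) where
  toLinearMap := LinearMap.toSpanSingleton F _ (colFun F a 1)
  isIntertwining' b := by
    refine LinearMap.ext_ring ?_
    change S p F a b 1 • colFun F a 1 = homRep p F a b.1 ((1 : F) • colFun F a 1)
    have h := colFun_mul_borel (F := F) a b b.1.unop⁻¹
    rw [inv_mul_cancel] at h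
    rw [one_smul, S_apply, mul_one, h, ← MulOpposite.op_unop b.1, homRep_colFun, mul_one,
      MulOpposite.unop_op]

variable (p F) in
/-- The projection of the homogeneous functions to `S_a`, by evaluation at the first basis
vector. -/
def projS (a : ℕ) : (res (homRep p F a)).IntertwiningMap (S p F a) where
  toLinearMap := LinearMap.proj e₁ ∘ₗ (homFun p F a).subtype
  isIntertwining' b := by
    ext f
    have hb : b.1.unop 1 0 = 0 := b.2
    change f.1 (actEquiv b.1.unop e₁) = S p F a b (f.1 e₁)
    rw [S_apply, actEquiv_e₁_of_borel hb]
    exact f.2.2 (Units.mk0 _ (borel_entry_ne_zero hb)) e₁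

theorem projS_inclS (a : ℕ) (x : F) : projS p F a (inclS p F a x) = x := by
  change (x • colFun F a (1 : G p)).1 e₁ = x
  rw [Submodule.coe_smul, colFun_one_val, Pi.smul_apply, lineFun_self a e₁_ne_zero, smul_eq_mul,
    mul_one]

theorem restrictLine_mem {a : ℕ} {f : Plane p → F} (hf : f ∈ homFun p F a) :
    restrictLine p F f ∈ homFun p F a := by
  refine ⟨by simp [restrictLine_apply, hf.1], fun c v => ?_⟩
  have hc : ((c : ZMod p) • v) 0 = 0 ↔ v 0 = 0 := by simp
  rw [restrictLine_apply, restrictLine_apply, hf.2]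
  by_cases hv : v 0 = 0
  · rw [if_pos (hc.2 hv), if_pos hv, mul_neg]
  · rw [if_neg (mt hc.1 hv), if_neg hv, mul_zero]

variable (p F) in
/-- The map `restrictLine` on homogeneous functions. -/
def homRestrictLine (a : ℕ) : homFun p F a →ₗ[F] homFun p F a :=
  (restrictLine p F).restrict fun _ hf => restrictLine_mem hf

theorem homRestrictLine_apply (a : ℕ) (f : homFun p F a) (v : Plane p) :
    (homRestrictLine p F a f).1 v = if v 0 = 0 then -f.1 v else 0 :=
  restrictLine_apply f.1 v

/-- There are `p - 1` upper triangular matrices mapping a vector off the first axis to the second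
axis. -/
theorem sum_borel_ite [Fintype (Bop p)] {v : Plane p} (hv : v 1 ≠ 0) (x : F) :
    ∑ b : Bop p, (if actEquiv b.1.unop v 0 = 0 then x else 0) = -x := by
  classical
  rw [← sum_units_const (p := p) (F := F)]
  symm
  -- The upper left entry c is free; the upper right entry -c v₀ / v₁ is then forced by the
  -- vanishing of the first coordinate of the image.
  have hdet : ∀ c : (ZMod p)ˣ,
      (c : ZMod p) * (c : ZMod p)⁻¹ - -(c * v 0 / v 1) * 0 = 1 := fun c => by
    rw [mul_zero, sub_zero, mul_inv_cancel₀ c.ne_zero]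
  let m : (ZMod p)ˣ → Bop p := fun c => ⟨MulOpposite.op (ofEntries _ _ _ _ (hdet c)), rfl⟩
  refine Finset.sum_of_injOn m ?_ (fun _ _ => Finset.mem_coe.2 (Finset.mem_univ _)) ?_ ?_
  · intro c _ d _ h
    exact Units.ext (congrArg (fun b : Bop p => b.1.unop 0 0) h)
  · intro b _ hb
    refine if_neg fun h => hb ?_
    have h10 : b.1.unop 1 0 = 0 := b.2
    have h00 := borel_entry_ne_zero h10
    refine ⟨Units.mk0 _ h00, Finset.mem_coe.2 (Finset.mem_univ _), ?_⟩
    have hb1 : b.1.unop 0 0 * b.1.unop 1 1 - b.1.unop 0 1 * b.1.unop 1 0 = 1 := by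
      rw [← Matrix.det_fin_two]; exact b.1.unop.2
    rw [h10, mul_zero, sub_zero] at hb1
    rw [actEquiv_apply] at h
    apply Subtype.ext
    apply MulOpposite.unop_injective
    ext i j
    fin_cases i <;> fin_cases j
    · rfl
    · change -(b.1.unop 0 0 * v 0 / v 1) = b.1.unop 0 1
      rw [neg_eq_iff_eq_neg, div_eq_iff hv]
      linear_combination h
    · exact h10.symm
    · change (b.1.unop 0 0)⁻¹ = b.1.unop 1 1
      exact inv_eq_of_mul_eq_one_right hb1
  · intro c _
    have h0 : (c : ZMod p) * v 0 + -(c * v 0 / v 1) * v 1 = 0 := by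
      rw [neg_mul, div_mul_cancel₀ _ hv, add_neg_cancel]
    rw [if_pos ((actEquiv_apply _ v 0).trans h0)]

/-- Off the first axis, p - 1 = -1 elements of `B` move a given vector to the second axis, so the
conjugates of the negated restriction add up to the identity. On the first axis both sides vanish by
`hf`. This is Higman's criterion for the complement of S_a. -/
theorem sum_restrictLine (a : ℕ) [Fintype (Bop p)] {f : homFun p F a} (hf : f.1 e₁ = 0) :
    ∑ b : Bop p, homRep p F a (b⁻¹ : Bop p).1 (homRestrictLine p F a (homRep p F a b.1 f)) = f := by
  ext v
  rw [Submodule.coe_sum, Finset.sum_apply]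
  have h : ∀ b : Bop p, (homRep p F a (b⁻¹ : Bop p).1
      (homRestrictLine p F a (homRep p F a b.1 f))).1 v =
      if actEquiv (b⁻¹ : Bop p).1.unop v 0 = 0 then -f.1 v else 0 := by
    intro b
    rw [homRep_apply, homRestrictLine_apply, homRep_apply]
    simp
  rw [Finset.sum_congr rfl fun b _ => h b]
  refine (Equiv.sum_comp (Equiv.inv (Bop p)) fun b : Bop p =>
    if actEquiv b.1.unop v 0 = 0 then -f.1 v else 0).trans ?_
  by_cases hv : v 1 = 0
  · have hfv : f.1 v = 0 := by
      by_cases hv0 : v 0 = 0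
      · rw [show v = 0 by ext i; fin_cases i <;> simp [hv0, hv]]
        exact f.2.1
      · rw [show v = ((Units.mk0 _ hv0 : (ZMod p)ˣ) : ZMod p) • e₁ by
          ext i; fin_cases i <;> simp [hv, e₁], f.2.2, hf, mul_zero]
    simp [hfv]
  · rw [sum_borel_ite hv, neg_neg]

theorem isSumProjective_res_homRep (a : ℕ) :
    IsSumProjective F[Bop p] (res (homRep p F a)).asModule (S p F a).asModule := by
  have : Fintype (Bop p) := Fintype.ofFinite _
  refine isSumProjective_of_intertwining (inclS p F a) (projS p F a) (projS_inclS a)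
    (homRestrictLine p F a) (fun f _ => ?_) (fun f hf => sum_restrictLine a hf)
  change (homRestrictLine p F a f).1 e₁ = 0
  rw [homRestrictLine_apply]
  simp [e₁]

theorem isSumProjective_res_ind (a : ℕ) :
    IsSumProjective F[Bop p] (res (ind (S p F a))).asModule (S p F a).asModule := by
  let E : (res (ind (S p F a))).Equiv (res (homRep p F a)) :=
    Representation.Equiv.mk (indEquiv p F a).toLinearEquiv fun b =>
      (indEquiv p F a).toIntertwiningMap.isIntertwining' b.1
  exact (isSumProjective_res_homRep a).of_linearEquiv (toModuleEquiv E)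

end GreenCorrespondence

end SLTwo

end

/-! ### The main theorem -/

open SLTwo in
theorem mainTheorem9 (p : ℕ) [Fact p.Prime] (hp : p ≠ 2)
    (F : Type*) [Field F] [IsAlgClosed F] [CharP F p] (a : ℕ) (ha : a ≤ p - 2) :
    HasCompositionFactors F[(G p)ᵐᵒᵖ] (ind (S p F a)).asModule
      (fun i : Fin 2 => (V p F (![a + 1, p - a] i)).asModule) ∧
    (a ≠ 0 →
      IsUniserial F[(G p)ᵐᵒᵖ] (ind (S p F a)).asModule ∧
      Nonempty (socle F[(G p)ᵐᵒᵖ] (ind (S p F a)).asModule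
        ≃ₗ[F[(G p)ᵐᵒᵖ]] (V p F (a + 1)).asModule) ∧
      Nonempty (Top F[(G p)ᵐᵒᵖ] (ind (S p F a)).asModule
        ≃ₗ[F[(G p)ᵐᵒᵖ]] (V p F (p - a)).asModule) ∧
      IsGreenCorrespondent (ind (S p F a)) (S p F a) ∧
      ∀ (W : Type*) [AddCommGroup W] [Module F W] (ρ : Representation F (G p)ᵐᵒᵖ W),
        IsGreenCorrespondent ρ (S p F a) →
          Nonempty (ρ.asModule ≃ₗ[F[(G p)ᵐᵒᵖ]] (ind (S p F a)).asModule)) := by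
  have hp2 : 2 ≤ p := (Fact.out : p.Prime).two_le
  let E := indEquiv p F a
  let ι := E.symm.toIntertwiningMap.comp (formToFun p F a)
  let π := (funToForm p F a (p - a)).comp E.toIntertwiningMap
  have hι : Function.Injective ι := E.symm.injective.comp (formToFun_injective (by omega))
  have hπ : Function.Surjective π := (funToForm_surjective (by omega)).comp E.surjective
  have hπι : ∀ x, π (ι x) = 0 := fun x =>
    (congrArg (funToForm p F a (p - a)) (E.apply_symm_apply _)).trans
      (funToForm_formToFun ha hp2 x)
  have hex : ∀ y, π y = 0 → ∃ x, ι x = y := fun y hy => by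
    obtain ⟨x, hx⟩ := mem_range_formToFun ha hp2 hy
    exact ⟨x, (congrArg E.symm hx).trans (E.symm_apply_apply y)⟩
  have hV₁ : IsSimpleModule F[(G p)ᵐᵒᵖ] (V p F (a + 1)).asModule :=
    (Representation.irreducible_iff_isSimpleModule_asModule _).1 (isIrreducible_V (by omega))
  have hV₂ : IsSimpleModule F[(G p)ᵐᵒᵖ] (V p F (p - a)).asModule :=
    (Representation.irreducible_iff_isSimpleModule_asModule _).1 (isIrreducible_V (by omega))
  refine ⟨?_, fun ha0 => ?_⟩
  · have : IsSimpleModule F[(G p)ᵐᵒᵖ] (V p F (![a + 1, p - a] 0)).asModule := hV₁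
    have : IsSimpleModule F[(G p)ᵐᵒᵖ] (V p F (![a + 1, p - a] 1)).asModule := hV₂
    refine hasCompositionFactors_of_extension
      (fun i : Fin 2 => (V p F (![a + 1, p - a] i)).asModule) (toModuleHom ι) (toModuleHom π)
      hι hπ (le_antisymm ?_ fun y hy => hex y hy)
    rintro _ ⟨x, rfl⟩
    exact hπι x
  obtain ⟨huni, hind, hsoc, htop⟩ := socle_and_top_of_nonsplit_extension hι hπ hπι hex
    fun θ => comp_formToFun_eq_zero ha hp2 ha0 (θ.comp E.symm.toIntertwiningMap)
  -- The projective summand of the induced module is taken to be zero, since the correspondent is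
  -- the whole induced module.
  refine ⟨huni, hsoc, htop, ⟨hind, ?_, ?_, not_projective_S a, isSumProjective_res_ind a,
    isSumProjective_self (LinearEquiv.refl _ _)⟩, fun W _ _ ρ hρ => ?_⟩
  · exact fun h => not_projective_homRep a (Module.Projective.of_equiv (toModuleEquiv E))
  · have := isSimpleModule_S (p := p) (F := F) a
    have := IsSimpleModule.nontrivial F[Bop p] (S p F a).asModule
    exact isUniserial_of_isSimpleModule.isIndecomposable
  · have := hρ.indecomposable.1
    exact hρ.ind_eq.nonempty_linearEquiv hind
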